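/- Let $T$ be a complete first-order theory in a language $L$, let $\mathfrak C$ be a monster model of $T$, and write $|T|=|L|+\aleph_0$. Let $\mathcal B$ be a complete Boolean algebra and let $x$ be a (possibly infinite) tuple of variables. For $A\subseteq\mathfrak C$, let $L_x(A)$ be the Boolean algebra of formulas in $x$ over $A$ up to equivalence in $\mathfrak C$. A $\mathcal B$-type in $x$ over $A$ is a homomorphism of Boolean algebras $L_x(A)\to\mathcal B$; the set of these is $S^x_{\mathcal B}(A)$. Two types $p_1,p_2\in S^x_{\mathcal B}(A)$ are image conjugates if $p_1=\sigma\circ p_2$ for some isomorphism $\sigma$ between subalgebras of $\mathcal B$ whose domain contains the image of $p_2$. For a cardinal $\theta$, let $\operatorname{ded}\theta$ be the supremum of the numbers of cuts of linear orders of cardinality $\le\theta$. (1) Let $\kappa$ be a regular infinite cardinal such that $\mathcal B$ is $\kappa$-c.c., i.e. $\mathcal B$ has no set of $\kappa$ pairwise disjoint nonzero elements. Let $A\subseteq\mathfrak C$ with $|A|\ge\aleph_0$, put $\mu=2^{<\kappa}+|T|+|x|$, and let $\lambda$ be the number of $\mathcal B$-types in $x$ over $A$ up to image conjugation. (a) If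 $T$ is stable, then $\lambda\le|A|^{\mu}$. (b) If $T$ is NIP, then $\lambda\le(\operatorname{ded}|A|)^{\mu}$. (2) Suppose that $T$ has IP and that $x$ is finite and nonempty. Then for every cardinal $\varkappa\ge|\mathcal B|+|T|$ (where $\mathfrak C$ is $\varkappa^{+}$-saturated, as a monster model is for every small $\varkappa$), $$\sup\{\,|S^x_{\mathcal B}(A)| : A\subseteq\mathfrak C,\ |A|\le\varkappa\,\}=|\mathcal B|^{\varkappa},$$ and the same holds with $|S^x_{\mathcal B}(A)|$ replaced by the number of $\mathcal B$-types in $x$ over $A$ up to image conjugation. -/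

import Mathlib

open Cardinal FirstOrder

universe u

namespace BooleanTypes

/-! ### Stability and NIP -/

section Theories

variable {L : FirstOrder.Language.{u, u}}

/-- The formula `φ(x, y)`, with `x`, `y` finite tuples of variables of lengths `m`, `n`, has the
independence property in `M`: for every `k` there are tuples `a 0, …, a (k - 1)` shattered by `φ`,
i.e. for every set `S` of indices some tuple `b S` satisfies `φ (b S, a i)` exactly when `i ∈ S`. -/
def HasIP (M : Type u) [L.Structure M] {m n : ℕ} (φ : L.Formula (Fin m ⊕ Fin n)) : Prop :=
  ∀ k : ℕ, ∃ (a : Fin k → Fin n → M) (b : Set (Fin k) → Fin m → M),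
    ∀ (i : Fin k) (S : Set (Fin k)), φ.Realize (Sum.elim (b S) (a i)) ↔ i ∈ S

/-- The formula `φ(x, y)` has the order property in `M`: for every `k` there are tuples `a i`,
`b j` (with `i, j < k`) such that `φ (a i, b j)` holds exactly when `i < j`. -/
def HasOP (M : Type u) [L.Structure M] {m n : ℕ} (φ : L.Formula (Fin m ⊕ Fin n)) : Prop :=
  ∀ k : ℕ, ∃ (a : Fin k → Fin m → M) (b : Fin k → Fin n → M),
    ∀ i j : Fin k, φ.Realize (Sum.elim (a i) (b j)) ↔ i < j

/-- `T` is NIP: no formula has the independence property in a model of `T`.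
`T` has IP if it is not NIP. -/
def IsNIP (T : L.Theory) : Prop :=
  ∀ (M : Type u) [L.Structure M] [Nonempty M] [M ⊨ T] (m n : ℕ)
    (φ : L.Formula (Fin m ⊕ Fin n)), ¬ HasIP M φ

/-- `T` is stable: no formula has the order property in a model of `T`. -/
def IsStable (T : L.Theory) : Prop :=
  ∀ (M : Type u) [L.Structure M] [Nonempty M] [M ⊨ T] (m n : ℕ)
    (φ : L.Formula (Fin m ⊕ Fin n)), ¬ HasOP M φ

variable (L) in
/-- `M` is `θ`-saturated: for every set `A ⊆ M` of fewer than `θ` parameters, every set of formulas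
over `A` in finitely many variables that is finitely satisfiable in `M` is realized in `M`. -/
def IsSaturated (M : Type u) [L.Structure M] (θ : Cardinal.{u}) : Prop :=
  ∀ A : Set M, #A < θ → ∀ (n : ℕ) (p : Set (L[[A]].Formula (Fin n))),
    (∀ s : Finset (L[[A]].Formula (Fin n)), (s : Set (L[[A]].Formula (Fin n))) ⊆ p →
      ∃ v : Fin n → M, ∀ φ ∈ s, φ.Realize v) →
    ∃ v : Fin n → M, ∀ φ ∈ p, φ.Realize v

end Theories

/-! ### Cardinal invariants -/

/-- `ded θ`: the supremum of the number of cuts of linear orders of cardinality at most `θ`.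
A cut is a partition into an initial and a final segment, given here by its initial segment. -/
noncomputable def ded (θ : Cardinal.{u}) : Cardinal.{u} :=
  sSup {c | ∃ (I : Type u) (_ : LinearOrder I), #I ≤ θ ∧ c = #(LowerSet I)}

/-- `B` is `κ`-c.c.: it has no antichain (set of pairwise disjoint nonzero elements) of
cardinality `κ`. -/
def IsCC (B : Type u) [BooleanAlgebra B] (κ : Cardinal.{u}) : Prop :=
  ¬ ∃ S : Set B, ⊥ ∉ S ∧ S.PairwiseDisjoint id ∧ #S = κ

/-! ### Boolean types -/

section Types

variable (L : FirstOrder.Language.{u, u}) {C : Type u} [L.Structure C]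

/-- The `B`-types over `A` in the tuple of variables `X`: homomorphisms of Boolean algebras to `B`
from the algebra of formulas in `X` over `A` up to equivalence in `C`. The equivalence class of a
formula is given by the set it defines in `C`. -/
abbrev BType (A : Set C) (X : Type u) (B : Type u) [BooleanAlgebra B] : Type u :=
  BoundedLatticeHom (L.DefinableSet A X) B

variable {L} {A : Set C} {X : Type u} {B : Type u} [BooleanAlgebra B]

/-- `p₁` and `p₂` are image conjugates: `p₁ = σ ∘ p₂` for an isomorphism `σ` between subalgebras
of `B` whose domain contains the image of `p₂`. -/
def ImageConj (p₁ p₂ : BType L A X B) : Prop :=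
  ∃ (B₁ B₂ : BooleanSubalgebra B) (σ : B₁ ≃o B₂),
    ∀ φ : L.DefinableSet A X, ∃ h : p₂ φ ∈ B₁, (σ ⟨p₂ φ, h⟩ : B) = p₁ φ

theorem imageConj_iff (p₁ p₂ : BType L A X B) :
    ImageConj p₁ p₂ ↔ ∀ φ ψ, p₁ φ ≤ p₁ ψ ↔ p₂ φ ≤ p₂ ψ := by
  constructor
  · rintro ⟨B₁, B₂, σ, h⟩ φ ψ
    obtain ⟨h₁, e₁⟩ := h φ
    obtain ⟨h₂, e₂⟩ := h ψ
    rw [← e₁, ← e₂, Subtype.coe_le_coe, σ.le_iff_le]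
    exact Iff.rfl
  · intro h
    have key : ∀ p q : BType L A X B, (∀ φ ψ, p φ ≤ p ψ ↔ q φ ≤ q ψ) →
        ∀ φ ψ, p φ = p ψ → q φ = q ψ := fun p q hpq φ ψ e =>
      le_antisymm ((hpq φ ψ).1 e.le) ((hpq ψ φ).1 e.ge)
    have mem : ∀ (p : BType L A X B) φ, p φ ∈ BooleanSubalgebra.map p ⊤ := fun p φ =>
      BooleanSubalgebra.mem_map.2 ⟨φ, BooleanSubalgebra.mem_top, rfl⟩
    have pre : ∀ (p : BType L A X B) (b : BooleanSubalgebra.map p ⊤), ∃ φ, p φ = b := fun p b => by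
      obtain ⟨φ, -, e⟩ := BooleanSubalgebra.mem_map.1 b.2
      exact ⟨φ, e⟩
    choose g hg using pre
    have h' : ∀ φ ψ, p₂ φ ≤ p₂ ψ ↔ p₁ φ ≤ p₁ ψ := fun φ ψ => (h φ ψ).symm
    let σ : BooleanSubalgebra.map p₂ ⊤ ≃o BooleanSubalgebra.map p₁ ⊤ :=
      { toFun := fun b => ⟨p₁ (g p₂ b), mem _ _⟩
        invFun := fun b => ⟨p₂ (g p₁ b), mem _ _⟩
        left_inv := fun b => Subtype.ext <|
          (key p₁ p₂ h _ _ (hg p₁ ⟨p₁ (g p₂ b), mem _ _⟩)).trans (hg p₂ b)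
        right_inv := fun b => Subtype.ext <|
          (key p₂ p₁ h' _ _ (hg p₂ ⟨p₂ (g p₁ b), mem _ _⟩)).trans (hg p₁ b)
        map_rel_iff' := fun {a b} => by
          change p₁ (g p₂ a) ≤ p₁ (g p₂ b) ↔ (a : B) ≤ b
          rw [h, hg, hg] }
    exact ⟨_, _, σ, fun φ => ⟨mem _ _, key p₂ p₁ h' _ _ (hg p₂ ⟨p₂ φ, mem _ _⟩)⟩⟩

variable (L A X B) in
/-- Image conjugation as an equivalence relation on the set of `B`-types. -/
def imageConjSetoid : Setoid (BType L A X B) where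
  r := ImageConj
  iseqv :=
    { refl := fun _ => (imageConj_iff _ _).2 fun _ _ => Iff.rfl
      symm := fun h => (imageConj_iff _ _).2 fun φ ψ => ((imageConj_iff _ _).1 h φ ψ).symm
      trans := fun h₁ h₂ => (imageConj_iff _ _).2 fun φ ψ =>
        ((imageConj_iff _ _).1 h₁ φ ψ).trans ((imageConj_iff _ _).1 h₂ φ ψ) }

variable (L A X B) in
/-- The set of `B`-types over `A` in `X` up to image conjugation. -/
def ImageConjClasses : Type u :=
  Quotient (imageConjSetoid L A X B)

end Types

end BooleanTypes

namespace BooleanTypes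

/-! ### Infinite combinatorics -/

/-! Part (1) reduces Boolean types to complete types. Up to image conjugation, `p` is the preorder
`p D ≤ p E` on definable sets. Under NIP the image of `p` has at most `μ` elements: by
`exists_independent`, more than `2 ^< κ` values on the instances of one formula would contain
independent families of every finite length, and patterns of nonzero value are realized in `C`,
which gives IP. For nontrivial `B`, separating each pair of values by an ultrafilter and pulling
back along `p` recovers the preorder from a `μ`-sequence of complete types. A complete type is
determined by its traces on the formulas; each formula has at most `#A` traces in the stable case
(Erdős–Makkai, `exists_halfGraph`) and at most `ded #A` under NIP (`exists_shattered`). With at most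
`μ` formulas the bound is `(θ ^ μ) ^ μ = θ ^ μ`.

In part (2) the upper bound counts all maps to `B` from an algebra of size at most `θ`. For the
lower bound, `exists_hasIP_one` gives a formula with IP in a single variable, and saturation gives
`θ` parameter tuples every subset of which is cut out by an element of `C`. This yields `2 ^ θ`
complete types, pairwise not conjugate as types with values `⊥` and `⊤`; and `#B ^ θ = 2 ^ θ` when
`2 ≤ #B ≤ θ`. -/

theorem card_fin_arrow_le {W : Type u} {θ : Cardinal.{u}} (hθ : ℵ₀ ≤ θ) (hW : #W ≤ θ) (n : ℕ) :
    #(Fin n → W) ≤ θ := by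
  rw [mk_arrow, mk_fin, lift_natCast, lift_uzero]
  exact_mod_cast (power_le_power_right hW).trans (power_nat_le hθ)

/-- Ramsey's theorem for pairs of natural numbers and two colours. -/
theorem exists_strictMono_homogeneous (c : ℕ → ℕ → Prop) :
    ∃ f : ℕ → ℕ, StrictMono f ∧
      ((∀ m n, m < n → c (f m) (f n)) ∨ ∀ m n, m < n → ¬ c (f m) (f n)) := by
  -- Each `j` takes the colour it has towards `U`-almost all `i`. One colour is taken `U`-often, and
  -- a sequence is chosen greedily inside that class.
  let U : Ultrafilter ℕ := Filter.hyperfilter ℕ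
  have large : ∀ k : ℕ, {i | k < i} ∈ U := fun k =>
    Filter.mem_hyperfilter_of_finite_compl <| by
      simpa [Set.compl_ofPred, not_lt] using Set.finite_le_nat k
  have key : ∀ d : ℕ → ℕ → Prop, {j | {i | d j i} ∈ U} ∈ U →
      ∃ f : ℕ → ℕ, StrictMono f ∧ ∀ m n, m < n → d (f m) (f n) := by
    intro d hd
    obtain ⟨f, -, hf⟩ := exists_seq_of_forall_finset_exists
      (fun j => {i | d j i} ∈ U) (fun j i => j < i ∧ d j i) (by
        intro s hs
        have h1 : (⋂ j ∈ s, {i | j < i ∧ d j i}) ∈ (U : Filter ℕ) :=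
          (Filter.biInter_finset_mem s).2 fun j hj => Filter.inter_mem (large j) (hs j hj)
        obtain ⟨i, hi⟩ := U.nonempty_of_mem (Filter.inter_mem hd h1)
        exact ⟨i, hi.1, fun j hj => Set.mem_iInter₂.1 hi.2 j hj⟩)
    exact ⟨f, strictMono_nat_of_lt_succ fun n => (hf n (n + 1) n.lt_succ_self).1,
      fun m n h => (hf m n h).2⟩
  by_cases h : {j | {i | c j i} ∈ U} ∈ U
  · obtain ⟨f, hf, h⟩ := key c h
    exact ⟨f, hf, Or.inl h⟩
  · obtain ⟨f, hf, h⟩ := key (fun j i => ¬ c j i) (by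
      have := Ultrafilter.compl_mem_iff_notMem.2 h
      refine Filter.mem_of_superset this fun j hj => ?_
      exact Ultrafilter.compl_mem_iff_notMem.2 hj)
    exact ⟨f, hf, Or.inr h⟩

/-- The Erdős–Makkai theorem: a family of more than `#W` subsets of an infinite set `W` contains
an infinite half graph. -/
theorem exists_halfGraph {W : Type u} [Infinite W] (F : Set (Set W)) (hF : #W < #F) :
    ∃ (S : ℕ → Set W) (w : ℕ → W), (∀ i, S i ∈ F) ∧
      ((∀ i j, w i ∈ S j ↔ j < i) ∨ ∀ i j, w i ∈ S j ↔ i ≤ j) := by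
  classical
  let V := Finset W × Finset W
  have hV : #V = #W := by simp [V, mk_finset_of_infinite]
  have : Infinite V := inferInstance
  obtain ⟨F₀, hF₀⟩ : F.Nonempty := by
    rw [← Set.nonempty_coe_sort, ← mk_ne_zero_iff]
    exact (zero_le.trans_lt hF).ne'
  have : ∀ v : V, ∃ S ∈ F, (∃ S' ∈ F, ↑v.1 ⊆ S' ∧ ↑v.2 ⊆ S'ᶜ) → ↑v.1 ⊆ S ∧ ↑v.2 ⊆ Sᶜ := fun v => by
    by_cases h : ∃ S' ∈ F, ↑v.1 ⊆ S' ∧ ↑v.2 ⊆ S'ᶜ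
    · obtain ⟨S, h1, h2⟩ := h
      exact ⟨S, h1, fun _ => h2⟩
    · exact ⟨F₀, hF₀, fun h' => (h h').elim⟩
  choose g hgF hg using this
  -- Finite Boolean combinations of the sets `g v`: finitely many `v`, and the admitted membership
  -- patterns. There are only `#W` of them, so some `S₀ ∈ F` is not one.
  let G : Finset V × Finset (Finset V) → Set W := fun q => {w | q.1.filter (fun v => w ∈ g v) ∈ q.2}
  obtain ⟨S₀, hS₀, hS₀'⟩ : ∃ S ∈ F, S ∉ Set.range G := by
    by_contra! h
    have h1 : #F ≤ #(Set.range G) := mk_le_mk_of_subset h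
    have h2 : #(Finset V × Finset (Finset V)) = #W := by
      simp [mk_finset_of_infinite, hV]
    exact (h1.trans (mk_range_le.trans h2.le)).not_gt hF
  -- Triples `(a, b, v)` with `a ∈ S₀` and `b ∉ S₀`. Earlier sets do not separate `a` from `b`
  -- (otherwise `S₀` would be a Boolean combination of them), and `g v` agrees with `S₀` on all
  -- points chosen so far.
  obtain ⟨f, hP, hr⟩ := exists_seq_of_forall_finset_exists (α := W × W × V)
    (fun x => x.1 ∈ S₀ ∧ x.2.1 ∉ S₀ ∧ x.1 ∈ g x.2.2 ∧ x.2.1 ∉ g x.2.2)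
    (fun x y => (y.1 ∈ g x.2.2 ↔ y.2.1 ∈ g x.2.2) ∧ x.1 ∈ g y.2.2 ∧ x.2.1 ∉ g y.2.2) (by
      intro s hs
      obtain ⟨a, ha, b, hb, hab⟩ : ∃ a ∈ S₀, ∃ b ∉ S₀, ∀ x ∈ s, (a ∈ g x.2.2 ↔ b ∈ g x.2.2) := by
        by_contra! h
        let t := s.image fun x => x.2.2
        refine hS₀' ⟨(t, t.powerset.filter fun r => ∃ a ∈ S₀, r = t.filter fun v => a ∈ g v), ?_⟩
        ext w
        simp only [G, Set.mem_ofPred_eq, Finset.mem_filter, Finset.mem_powerset,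
          Finset.filter_subset, true_and]
        constructor
        · rintro ⟨a, ha, e⟩
          by_contra hw
          obtain ⟨x, hx, hx'⟩ := h a ha w hw
          have := Finset.ext_iff.1 e x.2.2
          have hxt : x.2.2 ∈ t := Finset.mem_image_of_mem _ hx
          simp only [Finset.mem_filter, hxt, true_and] at this
          tauto
        · exact fun hw => ⟨w, hw, rfl⟩
      let v : V := (insert a (s.image Prod.fst), insert b (s.image fun x => x.2.1))
      have hv := hg v ⟨S₀, hS₀, by
        intro z hz
        simp only [v, Finset.coe_insert, Finset.coe_image, Set.mem_insert_iff] at hz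
        rcases hz with rfl | ⟨x, hx, rfl⟩
        exacts [ha, (hs x hx).1], by
        intro z hz
        simp only [v, Finset.coe_insert, Finset.coe_image, Set.mem_insert_iff] at hz
        rcases hz with rfl | ⟨x, hx, rfl⟩
        exacts [hb, (hs x hx).2.1]⟩
      refine ⟨(a, b, v), ⟨ha, hb, hv.1 (by simp [v]), hv.2 (by simp [v])⟩, fun x hx => ⟨hab x hx,
        hv.1 ?_, hv.2 ?_⟩⟩
      · simp only [v, Finset.coe_insert, Finset.coe_image]
        exact Or.inr ⟨x, hx, rfl⟩
      · simp only [v, Finset.coe_insert, Finset.coe_image]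
        exact Or.inr ⟨x, hx, rfl⟩)
  -- Ramsey decides uniformly whether later points lie in earlier sets. If they do, the points `b`
  -- form the half graph; if not, the points `a`.
  obtain ⟨e, he, h⟩ := exists_strictMono_homogeneous fun m n => (f n).1 ∈ g (f m).2.2
  rcases h with h | h
  · refine ⟨fun i => g (f (e i)).2.2, fun i => (f (e i)).2.1, fun i => hgF _, Or.inl fun i j => ?_⟩
    rcases lt_trichotomy i j with hij | rfl | hij
    · exact iff_of_false (hr _ _ (he hij)).2.2 hij.not_gt
    · exact iff_of_false (hP _).2.2.2 (lt_irrefl _)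
    · exact iff_of_true ((hr _ _ (he hij)).1.1 (h _ _ hij)) hij
  · refine ⟨fun i => g (f (e i)).2.2, fun i => (f (e i)).1, fun i => hgF _, Or.inr fun i j => ?_⟩
    rcases lt_trichotomy i j with hij | rfl | hij
    · exact iff_of_true (hr _ _ (he hij)).2.1 hij.le
    · exact iff_of_true (hP _).2.2.1 le_rfl
    · exact iff_of_false (h _ _ hij) hij.not_ge

/-! ### Cuts, branches of trees and shattering -/

theorem bddAbove_cuts (θ : Cardinal.{u}) :
    BddAbove {c | ∃ (I : Type u) (_ : LinearOrder I), #I ≤ θ ∧ c = #(LowerSet I)} := by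
  refine ⟨2 ^ θ, ?_⟩
  rintro c ⟨I, _, hI, rfl⟩
  calc #(LowerSet I) ≤ #(Set I) := mk_le_of_injective SetLike.coe_injective
    _ = 2 ^ #I := mk_set
    _ ≤ 2 ^ θ := power_le_power_left two_ne_zero hI

theorem card_lowerSet_le_ded {I : Type u} [LinearOrder I] {θ : Cardinal.{u}} (h : #I ≤ θ) :
    #(LowerSet I) ≤ ded θ :=
  le_csSup (bddAbove_cuts θ) ⟨I, _, h, rfl⟩

theorem le_ded (θ : Cardinal.{u}) : θ ≤ ded θ := by
  obtain ⟨_, _⟩ := exists_wellFoundedLT θ.out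
  calc θ = #θ.out := (mk_out θ).symm
    _ ≤ #(LowerSet θ.out) := mk_le_of_injective LowerSet.Iic_injective
    _ ≤ ded θ := card_lowerSet_le_ded (mk_out θ).le

section Trees

variable {W : Type u} [LinearOrder W]

/-- The truncation of the characteristic function `f` to the points below `β`. -/
def truncate (β : W) (f : W → Prop) : W → Prop := fun γ => γ < β ∧ f γ

theorem truncate_eq_iff {β : W} {f g : W → Prop} :
    truncate β f = truncate β g ↔ ∀ γ < β, (f γ ↔ g γ) := by
  simp only [truncate, funext_iff, eq_iff_iff, and_congr_right_iff]

theorem truncate_truncate {γ β : W} (h : γ ≤ β) (f : W → Prop) :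
    truncate γ (truncate β f) = truncate γ f :=
  truncate_eq_iff.2 fun δ hδ => by simp [truncate, hδ.trans_le h]

variable [WellFoundedLT W]

/-- A tree with at most `θ` nodes has at most `ded θ` branches. -/
theorem card_branches_le_ded {θ : Cardinal.{u}} (hθ : ℵ₀ ≤ θ) (hW : #W ≤ θ) (G : Set (W → Prop))
    (J : Set W) (hJ : IsLowerSet J) (hG : ∀ β ∈ J, #(truncate β '' G) ≤ θ)
    (hd : ∀ f ∈ G, ∀ g ∈ G, (∀ γ ∈ J, (f γ ↔ g γ)) → f = g) :
    #G ≤ ded θ := by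
  classical
  -- Nodes at level `β`, continued by true at `β` and false beyond. If `f` and `g` first differ at
  -- `β`, with `g β` true, the node of `g` at `β` lies in the lexicographic interval `(f, g]`, so
  -- distinct branches give distinct cuts of `I`.
  let I : Set (Lex (W → Prop)) :=
    ⋃ β : J, (fun s : W → Prop => toLex fun γ => s γ ∨ γ = β) '' (truncate (β : W) '' G)
  have hI : #I ≤ θ := by
    refine (mk_iUnion_le_sum_mk).trans ?_
    refine (sum_le_mk_mul_iSup _).trans ?_
    refine (mul_le_mul' ((mk_set_le J).trans hW)
      (ciSup_le' fun β : J => mk_image_le.trans (hG β β.2))).trans ?_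
    exact (mul_eq_self hθ).le
  refine (mk_le_of_injective (f := fun g : G => (⟨{i : I | (i : Lex (W → Prop)) ≤ toLex (g : W → Prop)},
    fun _ _ hba ha => Set.mem_ofPred.2 (le_trans hba (Set.mem_ofPred.1 ha))⟩ : LowerSet I)) ?_).trans (card_lowerSet_le_ded hI)
  have key : ∀ f g : G, toLex (f : W → Prop) < toLex (g : W → Prop) →
      {i : I | (i : Lex (W → Prop)) ≤ toLex (f : W → Prop)} ≠
        {i : I | (i : Lex (W → Prop)) ≤ toLex (g : W → Prop)} := by
    rintro f g ⟨β, h1, h2⟩ e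
    have hf : ¬ f.1 β := fun h => h2.not_ge fun _ => h
    have hg : g.1 β := by
      by_contra h
      exact h2.not_ge fun h' => (h h').elim
    have h1' : ∀ γ < β, (f.1 γ ↔ g.1 γ) := fun γ hγ => iff_of_eq (h1 γ hγ)
    have hβ : β ∈ J := by
      by_contra hβ
      have : f.1 = g.1 := hd f f.2 g g.2 fun γ hγ => h1' γ (lt_of_not_ge fun h => hβ (hJ h hγ))
      exact hf (this ▸ hg)
    let t : W → Prop := fun γ => truncate β g.1 γ ∨ γ = β
    have ht : toLex t ∈ I := Set.mem_iUnion.2 ⟨⟨β, hβ⟩, _, ⟨g, g.2, rfl⟩, rfl⟩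
    have htg : toLex t ≤ toLex g.1 := Pi.toLex_monotone fun γ hγ => by
      rcases hγ with h | rfl
      exacts [h.2, hg]
    have htf : toLex f.1 < toLex t := by
      refine ⟨β, fun γ hγ => ?_, ?_⟩
      · have : f.1 γ ↔ t γ := by simp [t, truncate, hγ, hγ.ne, h1' γ hγ]
        exact propext this
      · have : t β := Or.inr rfl
        exact lt_of_le_of_ne (fun h => (hf h).elim) fun h => hf (cast h.symm this)
    have := Set.ext_iff.1 e ⟨toLex t, ht⟩
    exact htf.not_ge (this.2 htg)
  intro f g hfg
  by_contra hne
  have hset := congrArg (fun s : LowerSet I => (s : Set I)) hfg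
  have hne' : toLex (f : W → Prop) ≠ toLex (g : W → Prop) := fun h => hne (Subtype.ext h)
  rcases lt_or_gt_of_ne hne' with h | h
  · exact key f g h hset
  · exact key g f h hset.symm

theorem exists_shattered_of_wellFoundedLT {θ : Cardinal.{u}} (hθ : ℵ₀ ≤ θ) (hW : #W ≤ θ) (n : ℕ) :
    ∀ F : Set (W → Prop), ded θ < #F →
      ∃ a : Fin n → W, ∀ S : Set (Fin n), ∃ f ∈ F, ∀ i, f (a i) ↔ i ∈ S := by
  induction n with
  | zero =>
    intro F hF
    obtain ⟨f, hf⟩ : F.Nonempty := by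
      rw [← Set.nonempty_coe_sort, ← mk_ne_zero_iff]
      exact (zero_le.trans_lt hF).ne'
    exact ⟨Fin.elim0, fun S => ⟨f, hf, fun i => i.elim0⟩⟩
  | succ n ih =>
    intro F hF
    by_contra hno
    have hded : ℵ₀ ≤ ded θ := hθ.trans (le_ded θ)
    -- Call a node large if more than `ded θ` members of `F` pass through it. Large nodes form a
    -- tree with at most `θ` nodes on each level, hence at most `ded θ` branches. A member of `F`
    -- either stays in this tree or leaves it at a least level, at a node shared by at most `ded θ`
    -- members.
    let Node (f : W → Prop) (β : W) : Set (W → Prop) := {g ∈ F | truncate β g = truncate β f}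
    let Lg (f : W → Prop) (β : W) : Prop := ded θ < #(Node f β)
    -- With more than `θ` large nodes on a level, two of them shatter the same `n`-tuple; adding a
    -- point below `β` where the nodes differ gives a shattered `(n + 1)`-tuple.
    have level : ∀ β, #(truncate β '' {f ∈ F | Lg f β}) ≤ θ := by
      intro β
      by_contra! hlt
      choose r hr hr' using fun s : truncate β '' {f ∈ F | Lg f β} => s.2
      choose a ha using fun s => ih (Node (r s) β) (hr s).2
      have hcard : #(Fin n → W) ≤ θ := card_fin_arrow_le hθ hW n
      obtain ⟨s, s', hss, hne⟩ : ∃ s s', a s = a s' ∧ s ≠ s' := by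
        have : ¬ Function.Injective a := fun h =>
          ((mk_le_of_injective h).trans hcard).not_gt hlt
        unfold Function.Injective at this
        push Not at this
        exact this
      have hne' : truncate β (r s) ≠ truncate β (r s') := by
        rw [hr', hr']
        exact fun h => hne (Subtype.ext h)
      have main : ∀ s s', a s = a s' → ∀ γ < β, ¬ r s γ → r s' γ → False := by
        intro s s' hss γ hγ h1 h2
        refine hno ⟨Fin.cons γ (a s), fun S => ?_⟩
        by_cases h0 : 0 ∈ S
        · obtain ⟨f, hf, hfS⟩ := ha s' {i | i.succ ∈ S}
          refine ⟨f, hf.1, fun i => ?_⟩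
          refine Fin.cases ?_ (fun i => ?_) i
          · simpa [h0] using (truncate_eq_iff.1 hf.2 γ hγ).2 h2
          · simpa [hss] using hfS i
        · obtain ⟨f, hf, hfS⟩ := ha s {i | i.succ ∈ S}
          refine ⟨f, hf.1, fun i => ?_⟩
          refine Fin.cases ?_ (fun i => ?_) i
          · simpa [h0] using fun h => h1 ((truncate_eq_iff.1 hf.2 γ hγ).1 h)
          · simpa using hfS i
      rw [Ne, truncate_eq_iff] at hne'
      push Not at hne'
      obtain ⟨γ, hγ, h | h⟩ := hne'
      · exact main s' s hss.symm γ hγ h.2 h.1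
      · exact main s s' hss γ hγ h.1 h.2
    let H (β : W) : Set (W → Prop) := {f ∈ F | ∀ γ < β, Lg f γ}
    have hH : ∀ β, #(truncate β '' H β) ≤ ded θ := by
      intro β
      refine card_branches_le_ded hθ hW _ (Set.Iio β) (isLowerSet_Iio β) (fun γ hγ => ?_) ?_
      · refine (mk_le_mk_of_subset ?_).trans (level γ)
        rintro _ ⟨_, ⟨f, hf, rfl⟩, rfl⟩
        exact ⟨f, ⟨hf.1, hf.2 γ hγ⟩, (truncate_truncate (le_of_lt hγ) f).symm⟩
      · rintro _ ⟨f, hf, rfl⟩ _ ⟨g, hg, rfl⟩ h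
        refine truncate_eq_iff.2 fun γ hγ => ?_
        simpa [truncate, hγ] using h γ hγ
    let K (β : W) : Set (W → Prop) := {f ∈ H β | ¬ Lg f β}
    have hK : ∀ β, #(K β) ≤ ded θ := by
      intro β
      have hsub : K β ⊆ ⋃ s : truncate β '' K β, {f ∈ F | truncate β f = (s : W → Prop)} := fun f hf =>
        Set.mem_iUnion.2 ⟨⟨_, f, hf, rfl⟩, hf.1.1, rfl⟩
      refine (mk_le_mk_of_subset hsub).trans (mk_iUnion_le_sum_mk.trans
        ((sum_le_mk_mul_iSup _).trans ?_))
      have h1 : #(truncate β '' K β) ≤ ded θ :=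
        (mk_le_mk_of_subset (Set.image_mono fun f hf => hf.1)).trans (hH β)
      refine (mul_le_mul' h1 (ciSup_le' (a := ded θ) ?_)).trans (mul_eq_self hded).le
      rintro ⟨_, f, hf, rfl⟩
      exact not_lt.1 hf.2
    have hU : #{f ∈ F | ∀ β, Lg f β} ≤ ded θ := by
      refine card_branches_le_ded hθ hW _ Set.univ isLowerSet_univ (fun γ _ => ?_) ?_
      · have h1 : {f ∈ F | ∀ β, Lg f β} ⊆ {f ∈ F | Lg f γ} := fun f hf => ⟨hf.1, hf.2 γ⟩
        exact (mk_le_mk_of_subset (Set.image_mono h1)).trans (level γ)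
      · exact fun f _ g _ h => funext fun γ => propext (h γ trivial)
    have hcover : F ⊆ {f ∈ F | ∀ β, Lg f β} ∪ ⋃ β, K β := by
      intro f hf
      by_cases h : ∀ β, Lg f β
      · exact Or.inl ⟨hf, h⟩
      · push Not at h
        obtain ⟨β, hβ, hmin⟩ := WellFounded.has_min (wellFounded_lt (α := W)) {β | ¬ Lg f β} h
        exact Or.inr (Set.mem_iUnion.2 ⟨β, ⟨hf, fun γ hγ => not_not.1 fun h => hmin γ h hγ⟩, hβ⟩)
    have : #F ≤ ded θ := by
      refine (mk_le_mk_of_subset hcover).trans ((mk_union_le _ _).trans ?_)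
      refine (add_le_add hU (mk_iUnion_le_sum_mk.trans ((sum_le_mk_mul_iSup _).trans
        (mul_le_mul' (hW.trans (le_ded θ)) (ciSup_le' hK))))).trans ?_
      rw [mul_eq_self hded, add_eq_self hded]
    exact this.not_gt hF

end Trees

/-- A family of more than `ded θ` subsets of a set of cardinality `≤ θ` shatters arbitrarily large
finite sets. -/
theorem exists_shattered {W : Type u} {θ : Cardinal.{u}} (hθ : ℵ₀ ≤ θ) (hW : #W ≤ θ) (n : ℕ)
    (F : Set (Set W)) (hF : ded θ < #F) :
    ∃ a : Fin n → W, ∀ S : Set (Fin n), ∃ f ∈ F, ∀ i, a i ∈ f ↔ i ∈ S := by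
  obtain ⟨_, _⟩ := exists_wellFoundedLT W
  exact exists_shattered_of_wellFoundedLT hθ hW n F hF

/-! ### Independent families in complete Boolean algebras -/

/-! ### Arithmetic of `2 ^< κ` for regular `κ` -/

section WeakPower

variable {κ : Cardinal.{u}}

theorem exists_wellOrder_of_isRegular (hκ : κ.IsRegular) :
    ∃ (K : Type u) (_ : LinearOrder K) (_ : WellFoundedLT K), #K = κ ∧
      (∀ i : K, #(Set.Iio i) < κ) ∧ ∀ s : Set K, #s < κ → ∃ δ, ∀ x ∈ s, x < δ := by
  refine ⟨κ.ord.ToType, inferInstance, inferInstance, mk_ord_toType κ, fun i =>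
    by simpa using Cardinal.mk_Iio_lt i (by simp), fun s hs => not_isCofinal_iff.1 fun h => ?_⟩
  have := Order.cof_le h
  rw [Ordinal.cof_toType, hκ.cof_ord] at this
  exact this.not_gt hs

theorem le_two_powerlt (κ : Cardinal.{u}) : κ ≤ 2 ^< κ := by
  by_contra! h
  exact ((cantor _).trans_le (le_powerlt 2 h)).false

/-- Elements of `Y` are coded by subsets of proper initial segments of `κ`. By regularity the codes
of fewer than `κ` values all lie below one `δ`, where there are fewer than `κ`-many bits to choose.
-/
theorem card_arrow_le_two_powerlt (hκ : κ.IsRegular) {X Y : Type u} (hX : #X < κ)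
    (hY : #Y ≤ 2 ^< κ) : #(X → Y) ≤ 2 ^< κ := by
  obtain ⟨K, _, _, hK, hlt, hbd⟩ := exists_wellOrder_of_isRegular hκ
  have hν : ℵ₀ ≤ 2 ^< κ := hκ.aleph0_le.trans (le_two_powerlt κ)
  let P : Set (K × Set K) := {q | q.2 ⊆ Set.Iio q.1}
  have hP : 2 ^< κ ≤ #P := by
    refine powerlt_le.2 fun x hx => ?_
    obtain ⟨s, rfl⟩ := le_mk_iff_exists_set.1 (hx.le.trans_eq hK.symm)
    obtain ⟨δ, hδ⟩ := hbd s hx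
    refine (mk_powerset s).symm.trans_le (mk_le_of_injective (f := fun t : 𝒫 s =>
      (⟨(δ, t), fun x h => hδ x (t.2 h)⟩ : P)) fun t t' h => ?_)
    simpa [Subtype.ext_iff] using h
  obtain ⟨e⟩ : Nonempty (Y ↪ P) := hY.trans hP
  let Pδ (δ : K) : Set (K × Set K) := {q | q ∈ P ∧ q.1 < δ}
  have hPδ : ∀ δ, #(Pδ δ) ≤ 2 ^ (#(Set.Iio δ) + #(Set.Iio δ)) := by
    intro δ
    have : Pδ δ ⊆ Set.Iio δ ×ˢ 𝒫 (Set.Iio δ) := fun q hq =>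
      ⟨hq.2, fun x hx => (Set.mem_Iio.1 (hq.1 hx)).trans hq.2⟩
    refine (mk_le_mk_of_subset this).trans ?_
    rw [mk_setProd, mk_powerset, power_add]
    exact mul_le_mul_left (cantor _).le _
  have hcover : (Set.univ : Set (X → Y)) ⊆ ⋃ δ, {f | ∀ x, (e (f x)).1.1 < δ} := by
    intro f _
    obtain ⟨δ, hδ⟩ := hbd (Set.range fun x => (e (f x)).1.1) (mk_range_le.trans_lt hX)
    exact Set.mem_iUnion.2 ⟨δ, fun x => hδ _ ⟨x, rfl⟩⟩
  rw [← mk_univ]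
  refine (mk_le_mk_of_subset hcover).trans (mk_iUnion_le_sum_mk.trans
    ((sum_le_mk_mul_iSup _).trans ?_))
  rw [hK]
  refine (mul_le_mul' (le_two_powerlt κ) (ciSup_le' (a := 2 ^< κ) fun δ => ?_)).trans
    (mul_eq_self hν).le
  calc #{f : X → Y | ∀ x, (e (f x)).1.1 < δ} ≤ #(X → Pδ δ) :=
        mk_le_of_injective (f := fun f x => ⟨(e (f.1 x)).1, (e (f.1 x)).2, f.2 x⟩)
          fun f g h => Subtype.ext <| funext fun x => e.injective <| Subtype.ext <|
            congrArg (fun q : Pδ δ => q.1) (congrFun h x)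
    _ = #(Pδ δ) ^ #X := by simp
    _ ≤ (2 ^ (#(Set.Iio δ) + #(Set.Iio δ))) ^ #X := power_le_power_right (hPδ δ)
    _ = 2 ^ ((#(Set.Iio δ) + #(Set.Iio δ)) * #X) := (power_mul ..).symm
    _ ≤ 2 ^< κ := le_powerlt 2 <| mul_lt_of_lt hκ.aleph0_le
      (add_lt_of_lt hκ.aleph0_le (hlt δ) (hlt δ)) hX

theorem card_small_subsets_le (hκ : κ.IsRegular) {α : Type u} (S : Set α) (hS : #S ≤ 2 ^< κ) :
    #{s : Set α | s ⊆ S ∧ #s < κ} ≤ 2 ^< κ := by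
  obtain ⟨K, _, _, hK, hlt, hbd⟩ := exists_wellOrder_of_isRegular hκ
  have hν : ℵ₀ ≤ 2 ^< κ := hκ.aleph0_le.trans (le_two_powerlt κ)
  have hcover : {s : Set α | s ⊆ S ∧ #s < κ} ⊆
      {∅} ∪ ⋃ δ : K, Set.range fun f : Set.Iio δ → S => Set.range fun i => (f i : α) := by
    rintro s ⟨hs, hs'⟩
    rcases s.eq_empty_or_nonempty with rfl | hne
    · exact Or.inl rfl
    · obtain ⟨t, ht⟩ := le_mk_iff_exists_set.1 (hs'.le.trans_eq hK.symm)
      obtain ⟨δ, hδ⟩ := hbd t (ht.trans_lt hs')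
      have h1 : #s ≤ #(Set.Iio δ) := ht.symm.trans_le (mk_le_mk_of_subset hδ)
      have := hne.to_subtype
      obtain ⟨e⟩ := h1
      refine Or.inr (Set.mem_iUnion.2 ⟨δ, fun i => ⟨(Function.invFun e i : s), hs (Subtype.prop _)⟩, ?_⟩)
      ext x
      constructor
      · rintro ⟨i, rfl⟩
        exact (Function.invFun e i).2
      · exact fun hx => ⟨e ⟨x, hx⟩, by simp [Function.leftInverse_invFun e.injective _]⟩
  refine (mk_le_mk_of_subset hcover).trans ((mk_union_le _ _).trans ?_)
  refine (add_le_add ((mk_singleton _).trans_le (one_le_aleph0.trans hν))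
    (mk_iUnion_le_sum_mk.trans ((sum_le_mk_mul_iSup _).trans
      (mul_le_mul' (hK.trans_le (le_two_powerlt κ)) (ciSup_le' (a := 2 ^< κ) fun δ =>
        mk_range_le.trans (card_arrow_le_two_powerlt hκ (hlt δ) hS)))))).trans ?_
  rw [mul_eq_self hν, add_eq_self hν]

/-- Closing off under an operation on sets whose arguments are of size less than `κ`. -/
theorem exists_closed_set (hκ : κ.IsRegular) {α : Type u} (Φ : Set α → Set α)
    (hΦ : ∀ S : Set α, #S ≤ 2 ^< κ → #(Φ S) ≤ 2 ^< κ) :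
    ∃ D : Set α, #D ≤ 2 ^< κ ∧ ∀ s ⊆ D, #s < κ → ∃ S, s ⊆ S ∧ Φ S ⊆ D := by
  obtain ⟨K, _, _, hK, hlt, hbd⟩ := exists_wellOrder_of_isRegular hκ
  have hν : ℵ₀ ≤ 2 ^< κ := hκ.aleph0_le.trans (le_two_powerlt κ)
  have hKν : #K ≤ 2 ^< κ := hK.trans_le (le_two_powerlt κ)
  -- `Φ` is iterated along `κ`. By regularity a set of fewer than `κ` elements of the union appears
  -- before some stage `δ`, and stage `δ` applies `Φ` to everything before it.
  let D : K → Set α := (wellFounded_lt (α := K)).fix fun i ih => Φ (⋃ j : Set.Iio i, ih j j.2)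
  have hD : ∀ i, D i = Φ (⋃ j : Set.Iio i, D j) := fun i => WellFounded.fix_eq _ _ _
  have hc : ∀ i, #(D i) ≤ 2 ^< κ := by
    intro i
    induction i using WellFoundedLT.induction with
    | ind i ih =>
      rw [hD]
      exact hΦ _ (mk_iUnion_le_sum_mk.trans ((sum_le_mk_mul_iSup _).trans
        ((mul_le_mul' ((mk_set_le _).trans hKν) (ciSup_le' fun j : Set.Iio i => ih j j.2)).trans
          (mul_eq_self hν).le)))
  refine ⟨⋃ i, D i, mk_iUnion_le_sum_mk.trans ((sum_le_mk_mul_iSup _).trans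
        ((mul_le_mul' hKν (ciSup_le' hc)).trans (mul_eq_self hν).le)), fun s hs hsκ => ?_⟩
  choose g hg using fun x : s => Set.mem_iUnion.1 (hs x.2)
  obtain ⟨δ, hδ⟩ := hbd (Set.range g) (mk_range_le.trans_lt hsκ)
  refine ⟨⋃ j : Set.Iio δ, D j, fun x hx => Set.mem_iUnion.2 ⟨⟨g ⟨x, hx⟩, hδ _ ⟨_, rfl⟩⟩, hg _⟩, ?_⟩
  rw [← hD]
  exact Set.subset_iUnion D δ

end WeakPower

/-! ### Projections to subalgebras and independent families -/

section Independent

variable {B : Type u} [CompleteBooleanAlgebra B] {κ : Cardinal.{u}}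

/-- `D` is a subalgebra of `B` closed under joins of fewer than `κ` elements. -/
structure IsSubalgebraLT (κ : Cardinal.{u}) (D : Set B) : Prop where
  compl_mem : ∀ b ∈ D, bᶜ ∈ D
  sSup_mem : ∀ s ⊆ D, #s < κ → sSup s ∈ D

theorem IsSubalgebraLT.sup_mem {D : Set B} (hD : IsSubalgebraLT κ D) (hκ : ℵ₀ ≤ κ) {a b : B}
    (ha : a ∈ D) (hb : b ∈ D) : a ⊔ b ∈ D := by
  rw [← sSup_pair]
  exact hD.sSup_mem _ (Set.pair_subset ha hb) ((Set.toFinite _).lt_aleph0.trans_le hκ)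

theorem IsSubalgebraLT.inf_mem {D : Set B} (hD : IsSubalgebraLT κ D) (hκ : ℵ₀ ≤ κ) {a b : B}
    (ha : a ∈ D) (hb : b ∈ D) : a ⊓ b ∈ D := by
  have := hD.compl_mem _ (hD.sup_mem hκ (hD.compl_mem _ ha) (hD.compl_mem _ hb))
  rwa [compl_sup, compl_compl, compl_compl] at this

/-- The join of all elements of `D` below `x`. -/
def lowerProj (D : Set B) (x : B) : B := sSup {d ∈ D | d ≤ x}

theorem lowerProj_le (D : Set B) (x : B) : lowerProj D x ≤ x := sSup_le fun _ h => h.2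

theorem le_lowerProj {D : Set B} {x d : B} (hd : d ∈ D) (h : d ≤ x) : d ≤ lowerProj D x :=
  le_sSup ⟨hd, h⟩

theorem IsCC.card_lt (hB : IsCC B κ) {S : Set B} (h : ⊥ ∉ S) (hS : S.PairwiseDisjoint id) :
    #S < κ := by
  by_contra! hle
  obtain ⟨t, ht, htκ⟩ := le_mk_iff_exists_subset.1 hle
  exact hB ⟨t, fun h' => h (ht h'), hS.subset ht, htκ⟩

/-- A maximal antichain of elements of `D` below `x` has the same join as all of them, and the chain
condition makes it smaller than `κ`. -/
theorem IsSubalgebraLT.lowerProj_mem {D : Set B} (hD : IsSubalgebraLT κ D) (hκ : ℵ₀ ≤ κ)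
    (hB : IsCC B κ) (x : B) : lowerProj D x ∈ D := by
  obtain ⟨m, -, hm⟩ := zorn_subset_nonempty
    {S : Set B | S ⊆ {d ∈ D | d ≤ x} ∧ ⊥ ∉ S ∧ S.PairwiseDisjoint id} (by
      intro c hc hchain _
      refine ⟨⋃₀ c, ⟨Set.sUnion_subset fun s hs => (hc hs).1, ?_, ?_⟩, fun s => Set.subset_sUnion_of_mem⟩
      · rintro ⟨s, hs, h⟩
        exact (hc hs).2.1 h
      · exact (Set.pairwiseDisjoint_sUnion hchain.directedOn).2 fun s hs => (hc hs).2.2)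
    ∅ ⟨Set.empty_subset _, by simp, by simp⟩
  obtain ⟨hmD, hm0, hmd⟩ := hm.prop
  have hsm : sSup m ∈ D := hD.sSup_mem m (fun d hd => (hmD hd).1) (hB.card_lt hm0 hmd)
  suffices lowerProj D x = sSup m by rwa [this]
  refine le_antisymm (sSup_le fun d hd => ?_) (sSup_le_sSup hmD)
  by_contra hle
  have hne : d ⊓ (sSup m)ᶜ ≠ ⊥ := fun h => hle (by rwa [← le_compl_iff_disjoint_right.trans
    disjoint_iff, compl_compl] at h)
  have hdis : ∀ e ∈ m, Disjoint (d ⊓ (sSup m)ᶜ) e := fun e he =>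
    (disjoint_compl_left.mono_left inf_le_right).mono_right (le_sSup he)
  have hmem : d ⊓ (sSup m)ᶜ ∈ m := by
    refine hm.le_of_ge (y := insert (d ⊓ (sSup m)ᶜ) m) ⟨?_, ?_, ?_⟩ (Set.subset_insert _ _)
      (Set.mem_insert _ _)
    · exact Set.insert_subset ⟨hD.inf_mem hκ hd.1 (hD.compl_mem _ hsm), inf_le_left.trans hd.2⟩ hmD
    · rintro (h | h)
      exacts [hne h.symm, hm0 h]
    · exact hmd.insert fun e he _ => hdis e he
  exact hne (disjoint_self.1 (hdis _ hmem))

/-- Every family of more than `2 ^< κ` elements of a complete `κ`-c.c. Boolean algebra contains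
independent families of every finite length (a theorem of Shelah). -/
theorem exists_independent (hκ : κ.IsRegular) (hB : IsCC B κ) (Y : Set B) (hY : 2 ^< κ < #Y)
    (k : ℕ) :
    ∃ x : Fin k → B, (∀ i, x i ∈ Y) ∧ ∀ S : Set (Fin k), ∃ b : B, b ≠ ⊥ ∧
      ∀ i, (i ∈ S → b ≤ x i) ∧ (i ∉ S → b ≤ (x i)ᶜ) := by
  classical
  have hκ0 := hκ.aleph0_le
  have hν : ℵ₀ ≤ 2 ^< κ := hκ0.trans (le_two_powerlt κ)
  -- For a good pair the projections stay fixed while `D` absorbs any small set, so the single gap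
  -- `(l ⊔ m)ᶜ` serves at every step of the induction below.
  let Good (l m : B) : Prop := ∀ E : Set B, #E ≤ 2 ^< κ → ∃ D, E ⊆ D ∧ IsSubalgebraLT κ D ∧
    ∃ x ∈ Y, lowerProj D x = l ∧ lowerProj D xᶜ = m
  -- bad pairs come with a set which witnesses that they are bad
  have hbad : ∀ l m : B, ∃ E : Set B, #E ≤ 2 ^< κ ∧ (¬ Good l m → ∀ D, E ⊆ D →
      IsSubalgebraLT κ D → ∀ x ∈ Y, lowerProj D x = l → lowerProj D xᶜ ≠ m) := by
    intro l m
    by_cases h : Good l m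
    · exact ⟨∅, by simp, fun h' => (h' h).elim⟩
    · simp only [Good] at h
      push Not at h
      obtain ⟨E, hE, h⟩ := h
      exact ⟨E, hE, fun _ => h⟩
  choose W hWc hW using hbad
  have closure : ∀ E : Set B, #E ≤ 2 ^< κ → ∃ D, E ⊆ D ∧ #D ≤ 2 ^< κ ∧ IsSubalgebraLT κ D ∧
      ∀ a ∈ D, ∀ b ∈ D, W a b ⊆ D := by
    intro E hE
    let Φ : Set B → Set B := fun S => E ∪ (compl '' S ∪ (sSup '' {s | s ⊆ S ∧ #s < κ} ∪
      ⋃ q : S × S, W q.1.1 q.2.1))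
    obtain ⟨D, hDc, hD⟩ := exists_closed_set hκ Φ (by
      intro S hS
      have h1 : #(⋃ q : S × S, W q.1.1 q.2.1) ≤ 2 ^< κ := by
        refine mk_iUnion_le_sum_mk.trans ((sum_le_mk_mul_iSup _).trans
          ((mul_le_mul' ?_ (ciSup_le' fun q => hWc _ _)).trans (mul_eq_self hν).le))
        rw [← mul_def]
        exact (mul_le_mul' hS hS).trans (mul_eq_self hν).le
      have h2 : #(sSup '' {s | s ⊆ S ∧ #s < κ}) ≤ 2 ^< κ :=
        mk_image_le.trans (card_small_subsets_le hκ S hS)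
      have h3 : #(compl '' S) ≤ 2 ^< κ := mk_image_le.trans hS
      have union : ∀ s t : Set B, #s ≤ 2 ^< κ → #t ≤ 2 ^< κ → #(s ∪ t : Set B) ≤ 2 ^< κ :=
        fun s t hs ht => (mk_union_le s t).trans ((add_le_add hs ht).trans (add_eq_self hν).le)
      exact union _ _ hE (union _ _ h3 (union _ _ h2 h1)))
    have fin : ∀ s : Set B, s.Finite → #s < κ := fun s hs => hs.lt_aleph0.trans_le hκ0
    refine ⟨D, ?_, hDc, ⟨fun b hb => ?_, fun s hs hsκ => ?_⟩, fun a ha b hb => ?_⟩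
    · obtain ⟨S, -, h⟩ := hD ∅ (Set.empty_subset _) (fin _ Set.finite_empty)
      exact fun x hx => h (Or.inl hx)
    · obtain ⟨S, hS, h⟩ := hD {b} (Set.singleton_subset_iff.2 hb) (fin _ (Set.finite_singleton b))
      exact h (Or.inr (Or.inl ⟨b, hS rfl, rfl⟩))
    · obtain ⟨S, hS, h⟩ := hD s hs hsκ
      exact h (Or.inr (Or.inr (Or.inl ⟨s, ⟨hS, hsκ⟩, rfl⟩)))
    · obtain ⟨S, hS, h⟩ := hD {a, b} (Set.pair_subset ha hb) (fin _ (Set.toFinite _))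
      exact fun x hx => h (Or.inr (Or.inr (Or.inr (Set.mem_iUnion.2
        ⟨(⟨a, hS (by simp)⟩, ⟨b, hS (by simp)⟩), hx⟩))))
  -- Take `D` closed under the witnesses `W` and `x ∈ Y` outside `D`. Its projections lie in `D`, so
  -- they cannot be a bad pair; if they joined to `⊤`, `x` would equal its own projection and lie in
  -- `D`.
  obtain ⟨l, m, hgood, hlm⟩ : ∃ l m, Good l m ∧ (l ⊔ m)ᶜ ≠ ⊥ := by
    obtain ⟨D, -, hDc, hD, hDW⟩ := closure ∅ (by simp)
    obtain ⟨x, hx, hxD⟩ : ∃ x ∈ Y, x ∉ D := by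
      by_contra! h
      exact ((mk_le_mk_of_subset h).trans hDc).not_gt hY
    refine ⟨lowerProj D x, lowerProj D xᶜ, ?_, fun h => hxD ?_⟩
    · by_contra h
      exact hW _ _ h D (hDW _ (hD.lowerProj_mem hκ0 hB x) _ (hD.lowerProj_mem hκ0 hB xᶜ)) hD x hx
        rfl rfl
    · have h1 : x ≤ lowerProj D x := by
        have h2 : x ≤ lowerProj D x ⊔ lowerProj D xᶜ := by rw [compl_eq_bot.1 h]; exact le_top
        exact Disjoint.left_le_of_le_sup_right h2
          (disjoint_compl_right.mono_right (lowerProj_le D xᶜ))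
      rw [← le_antisymm (lowerProj_le D x) h1]
      exact hD.lowerProj_mem hκ0 hB x
  suffices h : ∃ x : Fin k → B, (∀ i, x i ∈ Y) ∧ ∀ S : Set (Fin k), ∃ b : B, b ⊓ (l ⊔ m)ᶜ ≠ ⊥ ∧
      ∀ i, (i ∈ S → b ≤ x i) ∧ (i ∉ S → b ≤ (x i)ᶜ) by
    obtain ⟨x, hx, h⟩ := h
    refine ⟨x, hx, fun S => ?_⟩
    obtain ⟨b, hb, h⟩ := h S
    exact ⟨b, fun h => hb (by rw [h, bot_inf_eq]), h⟩
  induction k with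
  | zero => exact ⟨Fin.elim0, fun i => i.elim0, fun S => ⟨⊤, by simpa using hlm, fun i => i.elim0⟩⟩
  | succ k ih =>
    obtain ⟨x, hx, h⟩ := ih
    choose b hb hbx using h
    obtain ⟨D, hbD, hD, y, hy, rfl, rfl⟩ := hgood (Set.range b)
      ((Set.finite_range b).lt_aleph0.le.trans hν)
    have hw : (lowerProj D y ⊔ lowerProj D yᶜ)ᶜ ∈ D := hD.compl_mem _
      (hD.sup_mem hκ0 (hD.lowerProj_mem hκ0 hB _) (hD.lowerProj_mem hκ0 hB _))
    -- An element of `D` below `y` or `yᶜ` lies below the corresponding projection, hence outside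
    -- the gap. So `y` splits the part of each `b S` inside the gap.
    have key : ∀ z, lowerProj D z ≤ lowerProj D y ⊔ lowerProj D yᶜ → ∀ S,
        b S ⊓ (lowerProj D y ⊔ lowerProj D yᶜ)ᶜ ⊓ zᶜ ≠ ⊥ := by
      intro z hz S h0
      have h1 : b S ⊓ (lowerProj D y ⊔ lowerProj D yᶜ)ᶜ ≤ z := by
        rwa [← disjoint_iff, disjoint_compl_right_iff] at h0
      have h2 := (le_lowerProj (hD.inf_mem hκ0 (hbD ⟨S, rfl⟩) hw) h1).trans hz
      exact hb S (disjoint_self.1 (disjoint_compl_left.mono inf_le_right h2))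
    refine ⟨Fin.cons y x, Fin.cases hy hx, fun S => ?_⟩
    let S' : Set (Fin k) := {i | i.succ ∈ S}
    let w := (lowerProj D y ⊔ lowerProj D yᶜ)ᶜ
    have hle : ∀ c, b S' ⊓ w ⊓ c ≤ b S' := fun c => inf_le_left.trans inf_le_left
    have hcomm : ∀ c, b S' ⊓ w ⊓ c ⊓ w = b S' ⊓ w ⊓ c := fun c =>
      inf_eq_left.2 (inf_le_left.trans inf_le_right)
    by_cases h0 : (0 : Fin (k + 1)) ∈ S
    · refine ⟨b S' ⊓ w ⊓ y, ?_, Fin.cases ⟨fun _ => inf_le_right, fun h => (h h0).elim⟩ fun i =>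
        ⟨fun h => (hle y).trans ((hbx S' i).1 h), fun h => (hle y).trans ((hbx S' i).2 h)⟩⟩
      have := key yᶜ le_sup_right S'
      rw [compl_compl] at this
      rwa [hcomm]
    · refine ⟨b S' ⊓ w ⊓ yᶜ, ?_, Fin.cases ⟨fun h => (h0 h).elim, fun _ => inf_le_right⟩ fun i =>
        ⟨fun h => (hle yᶜ).trans ((hbx S' i).1 h), fun h => (hle yᶜ).trans ((hbx S' i).2 h)⟩⟩
      have := key y le_sup_left S'
      rwa [hcomm]

end Independent

/-! ### Counting Boolean types -/

/-- Two elements of a Boolean algebra which are not comparable are separated by an ultrafilter. -/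
theorem exists_hom_of_not_le {B : Type u} [BooleanAlgebra B] {b c : B} (h : ¬ b ≤ c) :
    ∃ χ : BoundedLatticeHom B Prop, χ b ∧ ¬ χ c := by
  obtain ⟨J, hJ, hcJ, hbJ⟩ := DistribLattice.prime_ideal_of_disjoint_filter_ideal
    (F := Order.PFilter.principal b) (I := Order.Ideal.principal c) (by
      rw [Set.disjoint_left]
      intro x hx hx'
      exact h ((Order.PFilter.mem_principal.1 hx).trans (Order.Ideal.mem_principal.1 hx')))
  refine ⟨{ toFun := fun x => x ∉ J, map_sup' := fun x y => ?_, map_inf' := fun x y => ?_,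
            map_top' := ?_, map_bot' := ?_ }, ?_, ?_⟩
  · simp only [Order.Ideal.sup_mem_iff, sup_Prop_eq, eq_iff_iff]
    tauto
  · have h1 : x ⊓ y ∈ J ↔ x ∈ J ∨ y ∈ J :=
      ⟨hJ.mem_or_mem, fun h => h.elim (J.lower inf_le_left) (J.lower inf_le_right)⟩
    simp only [h1, inf_Prop_eq, eq_iff_iff]
    tauto
  · exact eq_true fun h => hJ.toIsProper.top_notMem h
  · exact eq_false fun h => h J.bot_mem
  · exact fun h => Set.disjoint_left.1 hbJ (Order.PFilter.mem_principal.2 le_rfl) h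
  · exact fun h => h (hcJ (Order.Ideal.mem_principal.2 le_rfl))

/-! ### Instances of formulas, traces, and part (1) -/

section Instances

variable {L : FirstOrder.Language.{u, u}} {C : Type u} [L.Structure C] {A : Set C} {X : Type u}

/-- The set defined by the instance `φ(x, a)` of `φ`, where `x` is the subtuple `t` of the tuple
of variables `X`. -/
def instanceSet {m n : ℕ} (φ : L.Formula (Fin m ⊕ Fin n)) (t : Fin m → X) (a : Fin n → A) :
    L.DefinableSet A X :=
  ⟨{v | φ.Realize (Sum.elim (v ∘ t) fun i => (a i : C))}, Set.definable_iff_exists_formula_sum.2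
    ⟨φ.relabel (Sum.elim (Sum.inr ∘ t) (Sum.inl ∘ a)), by
      ext v
      simp only [Set.mem_ofPred_eq, Language.Formula.realize_relabel]
      refine iff_of_eq (congrArg _ (funext fun i => ?_))
      rcases i with i | i <;> rfl⟩⟩

theorem mem_instanceSet {m n : ℕ} {φ : L.Formula (Fin m ⊕ Fin n)} {t : Fin m → X}
    {a : Fin n → A} {v : X → C} :
    v ∈ instanceSet φ t a ↔ φ.Realize (Sum.elim (v ∘ t) fun i => (a i : C)) := Iff.rfl

variable (L X) in
/-- Formulas whose first variables are substituted by variables from `X`. -/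
abbrev FormulaIndex : Type u :=
  Σ m : ℕ, Σ n : ℕ, L.Formula (Fin m ⊕ Fin n) × (Fin m → X)

/-- A formula has only finitely many free variables and parameters; numbering them makes it an
instance of a parameter-free formula in finite tuples. -/
theorem exists_eq_instanceSet (D : L.DefinableSet A X) :
    ∃ (q : FormulaIndex L X) (a : Fin q.2.1 → A), D = instanceSet q.2.2.1 q.2.2.2 a := by
  classical
  obtain ⟨s, hs⟩ := D
  obtain ⟨φ, rfl⟩ := Set.definable_iff_exists_formula_sum.1 hs
  let e := φ.freeVarFinset.toRight.equivFin
  let e' := φ.freeVarFinset.toLeft.equivFin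
  let f : φ.freeVarFinset → Fin φ.freeVarFinset.toRight.card ⊕ Fin φ.freeVarFinset.toLeft.card :=
    fun x => match x with
      | ⟨Sum.inl a, h⟩ => Sum.inr (e' ⟨a, Finset.mem_toLeft.2 h⟩)
      | ⟨Sum.inr a, h⟩ => Sum.inl (e ⟨a, Finset.mem_toRight.2 h⟩)
  refine ⟨⟨_, _, Language.BoundedFormula.restrictFreeVar φ f, fun i => (e.symm i : X)⟩,
    fun i => (e'.symm i : A), Subtype.ext (Set.ext fun v => ?_)⟩
  refine (Language.BoundedFormula.realize_restrictFreeVar (Sum.elim (fun x : A => (x : C)) v) ?_).symm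
  rintro ⟨a | a, h⟩ <;> simp [f]

theorem card_formula_le {α : Type} [Countable α] : #(L.Formula α) ≤ max ℵ₀ L.card := by
  have h : #(L.Formula α) ≤ #(Σ n, L.BoundedFormula α n) :=
    mk_le_of_injective (f := fun φ : L.Formula α => (⟨0, φ⟩ : Σ n, L.BoundedFormula α n))
      fun φ ψ h => by simpa using h
  refine h.trans (Language.BoundedFormula.card_le.trans ?_)
  rw [lift_uzero, max_le_iff]
  refine ⟨le_max_left _ _, ?_⟩
  refine (add_le_add (b := max ℵ₀ L.card) (d := max ℵ₀ L.card) ?_ ?_).trans_eq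
    (add_eq_self (le_max_left _ _))
  swap
  · exact le_max_right _ _
  exact (lift_le_aleph0.2 mk_le_aleph0).trans (le_max_left _ _)

theorem card_formulaIndex_le {θ : Cardinal.{u}} (hL : max ℵ₀ L.card ≤ θ) (hX : #X ≤ θ) :
    #(FormulaIndex L X) ≤ θ := by
  have hθ : ℵ₀ ≤ θ := (le_max_left _ _).trans hL
  have sum_le : ∀ f : ℕ → Type u, (∀ n, #(f n) ≤ θ) → #(Σ n, f n) ≤ θ := fun f hf => by
    rw [mk_sigma]
    refine (sum_le_lift_mk_mul_iSup _).trans ?_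
    refine (mul_le_mul' (b := θ) (by simpa using hθ) (ciSup_le' hf)).trans (mul_eq_self hθ).le
  refine sum_le _ fun m => sum_le _ fun n => ?_
  rw [← mul_def]
  exact (mul_le_mul' (card_formula_le.trans hL) (card_fin_arrow_le hθ hX m)).trans
    (mul_eq_self hθ).le

/-- A pattern of instances to which a Boolean type gives a nonzero value is realized. -/
theorem exists_realize_pattern {B : Type*} [BooleanAlgebra B]
    (p : BoundedLatticeHom (L.DefinableSet A X) B) {m n k : ℕ} (φ : L.Formula (Fin m ⊕ Fin n))
    (t : Fin m → X) (a : Fin k → Fin n → A) (S : Set (Fin k)) (b : B) (hb : b ≠ ⊥)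
    (h : ∀ i, (i ∈ S → b ≤ p (instanceSet φ t (a i))) ∧
      (i ∉ S → b ≤ (p (instanceSet φ t (a i)))ᶜ)) :
    ∃ v : X → C, ∀ i, φ.Realize (Sum.elim (v ∘ t) fun j => (a i j : C)) ↔ i ∈ S := by
  classical
  let f : Fin k → L.DefinableSet A X := fun i =>
    if i ∈ S then instanceSet φ t (a i) else (instanceSet φ t (a i))ᶜ
  have hle : b ≤ p (Finset.univ.inf f) := by
    rw [map_finset_inf]
    refine Finset.le_inf fun i _ => ?_
    by_cases hi : i ∈ S
    · simpa [f, hi] using (h i).1 hi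
    · simpa [f, hi, map_compl'] using (h i).2 hi
  have hne : Finset.univ.inf f ≠ ⊥ := fun h0 => hb (by rwa [h0, map_bot, le_bot_iff] at hle)
  obtain ⟨v, hv⟩ : ∃ v, v ∈ Finset.univ.inf f := by
    by_contra! h0
    exact hne (SetLike.ext fun v => iff_of_false (h0 v) Language.DefinableSet.notMem_bot)
  refine ⟨v, fun i => ?_⟩
  have hvi : v ∈ f i := Finset.inf_le (f := f) (Finset.mem_univ i) hv
  by_cases hi : i ∈ S
  · simpa [f, hi, mem_instanceSet] using hvi
  · simpa [f, hi, mem_instanceSet] using hvi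

/-- The set of parameters `a` such that `φ(x, a)` belongs to the complete type `q`. -/
def trace {m n : ℕ} (φ : L.Formula (Fin m ⊕ Fin n)) (t : Fin m → X)
    (q : BoundedLatticeHom (L.DefinableSet A X) Prop) : Set (Fin n → A) :=
  {a | q (instanceSet φ t a)}

theorem exists_realize_trace {m n k : ℕ} (φ : L.Formula (Fin m ⊕ Fin n)) (t : Fin m → X)
    (q : BoundedLatticeHom (L.DefinableSet A X) Prop) (a : Fin k → Fin n → A) :
    ∃ v : X → C, ∀ i, φ.Realize (Sum.elim (v ∘ t) fun j => (a i j : C)) ↔ a i ∈ trace φ t q := by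
  refine exists_realize_pattern q φ t a {i | a i ∈ trace φ t q} ⊤ (top_ne_bot (α := Prop))
    fun i => ⟨fun h => ?_, fun h => ?_⟩
  · have h1 : q (instanceSet φ t (a i)) := h
    exact fun _ => h1
  · have h1 : ¬ q (instanceSet φ t (a i)) := h
    exact fun _ => h1

theorem card_range_trace_le_ded (hA : ℵ₀ ≤ #A) {m n : ℕ} (φ : L.Formula (Fin m ⊕ Fin n))
    (hφ : ¬ HasIP C φ) (t : Fin m → X) :
    #(Set.range (trace (A := A) φ t)) ≤ ded #A := by
  by_contra! hlt
  refine hφ fun k => ?_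
  obtain ⟨a, ha⟩ := exists_shattered hA (card_fin_arrow_le hA le_rfl n) k _ hlt
  choose f hf hfS using ha
  choose q hq using hf
  choose v hv using fun S => exists_realize_trace φ t (q S) a
  refine ⟨fun i j => a i j, fun S => v S ∘ t, fun i S => ?_⟩
  rw [hv, hq, hfS]

theorem card_range_trace_le (hA : ℵ₀ ≤ #A) {m n : ℕ} (φ : L.Formula (Fin m ⊕ Fin n))
    (hφ : ¬ HasOP C φ) (hφ' : ¬ HasOP C φ.not) (t : Fin m → X) :
    #(Set.range (trace (A := A) φ t)) ≤ #A := by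
  -- As `A` is infinite, the finite case is `n = 0`.
  rcases finite_or_infinite (Fin n → A) with hfin | hinf
  · exact (Set.toFinite _).lt_aleph0.le.trans hA
  by_contra! hlt
  obtain ⟨S, w, hS, h⟩ := exists_halfGraph _ ((card_fin_arrow_le hA le_rfl n).trans_lt hlt)
  choose q hq using hS
  rcases h with h | h
  · refine hφ fun k => ?_
    choose v hv using fun j => exists_realize_trace φ t (q j) (fun i : Fin k => w i)
    refine ⟨fun j => v j ∘ t, fun i j => w i j, fun i j => ?_⟩
    rw [hv i j, hq, h, Fin.lt_def]
  · refine hφ' fun k => ?_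
    choose v hv using fun j => exists_realize_trace φ t (q j) (fun i : Fin k => w i)
    refine ⟨fun j => v j ∘ t, fun i j => w i j, fun i j => ?_⟩
    rw [Language.Formula.realize_not, hv i j, hq, h, Fin.lt_def, not_le]

theorem card_completeTypes_le {θ : Cardinal.{u}}
    (h : ∀ q : FormulaIndex L X, #(Set.range (trace (A := A) q.2.2.1 q.2.2.2)) ≤ θ) :
    #(BoundedLatticeHom (L.DefinableSet A X) Prop) ≤ θ ^ #(FormulaIndex L X) := by
  calc #(BoundedLatticeHom (L.DefinableSet A X) Prop)
      ≤ #(∀ q : FormulaIndex L X, Set.range (trace (A := A) q.2.2.1 q.2.2.2)) :=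
        mk_le_of_injective (f := fun p q => ⟨trace q.2.2.1 q.2.2.2 p, p, rfl⟩) fun p p' hpp => by
          refine DFunLike.ext _ _ fun D => ?_
          obtain ⟨q, a, rfl⟩ := exists_eq_instanceSet D
          have h1 : trace q.2.2.1 q.2.2.2 p = trace q.2.2.1 q.2.2.2 p' :=
            congrArg Subtype.val (congrFun hpp q)
          exact propext (Set.ext_iff.1 h1 a)
    _ ≤ prod fun _ : FormulaIndex L X => θ := by
        rw [mk_pi]
        exact prod_le_prod _ _ h
    _ = θ ^ #(FormulaIndex L X) := prod_const' _ _

theorem card_range_le {B : Type u} [CompleteBooleanAlgebra B] {κ μ : Cardinal.{u}}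
    (hκ : κ.IsRegular) (hB : IsCC B κ) (hκμ : 2 ^< κ ≤ μ) (hL : max ℵ₀ L.card ≤ μ) (hX : #X ≤ μ)
    (hC : ∀ (m n : ℕ) (φ : L.Formula (Fin m ⊕ Fin n)), ¬ HasIP C φ) (p : BType L A X B) :
    #(Set.range p) ≤ μ := by
  have hμ : ℵ₀ ≤ μ := (le_max_left _ _).trans hL
  have hcover : Set.range p ⊆ ⋃ q : FormulaIndex L X,
      Set.range fun a : Fin q.2.1 → A => p (instanceSet q.2.2.1 q.2.2.2 a) := by
    rintro _ ⟨D, rfl⟩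
    obtain ⟨q, a, rfl⟩ := exists_eq_instanceSet D
    exact Set.mem_iUnion.2 ⟨q, a, rfl⟩
  refine (mk_le_mk_of_subset hcover).trans (mk_iUnion_le_sum_mk.trans
    ((sum_le_mk_mul_iSup _).trans ((mul_le_mul' (card_formulaIndex_le hL hX)
      (ciSup_le' fun q => le_trans ?_ hκμ)).trans (mul_eq_self hμ).le)))
  by_contra! hlt
  refine hC _ _ q.2.2.1 fun k => ?_
  obtain ⟨x, hx, h⟩ := exists_independent hκ hB _ hlt k
  choose a ha using hx
  choose b hb hbx using h
  choose v hv using fun S => exists_realize_pattern p q.2.2.1 q.2.2.2 a S (b S) (hb S) fun i => by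
    have hi := hbx S i
    rwa [← ha i] at hi
  exact ⟨fun i j => a i j, fun S => v S ∘ q.2.2.2, fun i S => hv S i⟩

/-- By `imageConj_iff` the preorder determines the class, and one ultrafilter for each of at most
`μ` pairs of values recovers the preorder. The `max 1` covers trivial `B`, which has no ultrafilter
but still one type. -/
theorem card_imageConjClasses_le {B : Type u} [BooleanAlgebra B] {μ : Cardinal.{u}} (hμ : ℵ₀ ≤ μ)
    (h : ∀ p : BType L A X B, #(Set.range p) ≤ μ) :
    #(ImageConjClasses L A X B) ≤ max 1 (#(BoundedLatticeHom (L.DefinableSet A X) Prop) ^ μ) := by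
  rcases subsingleton_or_nontrivial B with hB | hB
  · refine le_trans ?_ (le_max_left _ _)
    have : Subsingleton (BType L A X B) := DFunLike.subsingleton_cod
    exact le_one_iff_subsingleton.2 (inferInstanceAs (Subsingleton (Quotient _)))
  refine le_trans ?_ (le_max_right _ _)
  have sep : ∀ p : BType L A X B, ∃ U : μ.out → BoundedLatticeHom (L.DefinableSet A X) Prop,
      ∀ D E, p D ≤ p E ↔ ∀ i, U i D → U i E := by
    intro p
    have hχ : ∀ b c : B, ∃ χ : BoundedLatticeHom B Prop, ¬ b ≤ c → χ b ∧ ¬ χ c := fun b c => by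
      by_cases hbc : b ≤ c
      · obtain ⟨χ, -⟩ := exists_hom_of_not_le (B := B) (b := ⊤) (c := ⊥) (by simp)
        exact ⟨χ, fun h => (h hbc).elim⟩
      · obtain ⟨χ, h⟩ := exists_hom_of_not_le hbc
        exact ⟨χ, fun _ => h⟩
    choose χ hχ using hχ
    have hcard : #(Set.range p × Set.range p) ≤ #μ.out := by
      rw [← mul_def, mk_out]
      exact (mul_le_mul' (h p) (h p)).trans (mul_eq_self hμ).le
    have : Nonempty (Set.range p × Set.range p) := ⟨⟨_, ⊤, rfl⟩, ⟨_, ⊤, rfl⟩⟩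
    obtain ⟨e⟩ := hcard
    refine ⟨fun i => (χ (Function.invFun e i).1.1 (Function.invFun e i).2.1).comp p, fun D E =>
      ⟨fun hDE i => ?_, fun hi => ?_⟩⟩
    · exact OrderHomClass.mono (χ _ _) hDE
    · by_contra hDE
      have h1 := hi (e (⟨p D, D, rfl⟩, ⟨p E, E, rfl⟩))
      simp only [Function.leftInverse_invFun e.injective _] at h1
      exact (hχ _ _ hDE).2 (h1 (hχ _ _ hDE).1)
  choose U hU using sep
  calc #(ImageConjClasses L A X B)
      ≤ #(μ.out → BoundedLatticeHom (L.DefinableSet A X) Prop) :=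
        mk_le_of_injective (f := fun c : ImageConjClasses L A X B => U (Quotient.out c))
          fun c c' hcc => by
            rw [← Quotient.out_eq c, ← Quotient.out_eq c']
            refine Quotient.sound ((imageConj_iff _ _).2 fun D E => ?_)
            have hcc' : U (Quotient.out c) = U (Quotient.out c') := hcc
            rw [hU, hU, hcc']
    _ = _ := by simp

theorem card_imageConjClasses_le_power {B : Type u} [CompleteBooleanAlgebra B]
    {κ μ θ : Cardinal.{u}} (hκ : κ.IsRegular) (hB : IsCC B κ) (hκμ : 2 ^< κ ≤ μ)
    (hL : max ℵ₀ L.card ≤ μ) (hX : #X ≤ μ) (hθ : ℵ₀ ≤ θ)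
    (hC : ∀ (m n : ℕ) (φ : L.Formula (Fin m ⊕ Fin n)), ¬ HasIP C φ)
    (h : ∀ q : FormulaIndex L X, #(Set.range (trace (A := A) q.2.2.1 q.2.2.2)) ≤ θ) :
    #(ImageConjClasses L A X B) ≤ θ ^ μ := by
  have hμ : ℵ₀ ≤ μ := (le_max_left _ _).trans hL
  have hθ1 : 1 ≤ θ := one_le_aleph0.trans hθ
  refine (card_imageConjClasses_le hμ (card_range_le hκ hB hκμ hL hX hC)).trans (max_le ?_ ?_)
  · exact Cardinal.one_le_iff_ne_zero.2 (power_pos _ (zero_lt_one.trans_le hθ1)).ne'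
  · refine (power_le_power_right (card_completeTypes_le h)).trans ?_
    rw [← power_mul]
    exact power_le_power_left (zero_lt_one.trans_le hθ1).ne'
      ((mul_le_mul' (card_formulaIndex_le hL hX) le_rfl).trans (mul_eq_self hμ).le)

end Instances

theorem HasIP.hasOP {L : FirstOrder.Language.{u, u}} {M : Type u} [L.Structure M] {m n : ℕ}
    {φ : L.Formula (Fin m ⊕ Fin n)} (h : HasIP M φ) : HasOP M φ := fun k => by
  obtain ⟨a, b, hab⟩ := h k
  exact ⟨fun i => b {j | i < j}, a, fun i j => hab j {j | i < j}⟩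

theorem IsStable.isNIP {L : FirstOrder.Language.{u, u}} {T : L.Theory} (h : IsStable T) :
    IsNIP T := fun M _ _ _ m n φ hφ => h M m n φ hφ.hasOP

/-! ### Finite combinatorics of shattering -/

section Shattering

variable {α α' β β' γ ι ι' : Type*}

/-- The family `y` is shattered by the relation `R`. -/
def Shattered (R : α → β → Prop) (y : ι → β) : Prop :=
  ∀ S : Set ι, ∃ a, ∀ i, R a (y i) ↔ i ∈ S

theorem Shattered.comp {R : α → β → Prop} {y : ι → β} (h : Shattered R y) {f : ι' → ι}
    (hf : Function.Injective f) : Shattered R (y ∘ f) := fun S => by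
  obtain ⟨a, ha⟩ := h (f '' S)
  exact ⟨a, fun i => (ha _).trans (hf.mem_set_image)⟩

theorem Shattered.injective {R : α → β → Prop} {y : ι → β} (h : Shattered R y) :
    Function.Injective y := fun i j hij => by
  obtain ⟨a, ha⟩ := h {i}
  have := (ha j).1 (hij ▸ (ha i).2 rfl)
  exact (Set.mem_singleton_iff.1 this).symm

theorem Shattered.map {R : α → β → Prop} {R' : α' → β' → Prop} {y : ι → β} (h : Shattered R y)
    (f : α → α') (g : β → β') (hfg : ∀ a b, R' (f a) (g b) ↔ R a b) : Shattered R' (g ∘ y) :=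
  fun S => by
    obtain ⟨a, ha⟩ := h S
    exact ⟨f a, fun i => (hfg _ _).trans (ha i)⟩

/-- A polynomial form of the Sauer–Shelah lemma. -/
theorem card_le_of_not_shattered [Fintype ι] [DecidableEq ι] (𝒜 : Finset (Finset ι)) (d : ℕ)
    (h : ∀ e : Fin d → ι, ¬ Shattered (fun (s : 𝒜) i => i ∈ s.1) e) :
    𝒜.card ≤ (Fintype.card ι + 1) ^ d := by
  have hdim : 𝒜.vcDim ≤ d := by
    refine Finset.sup_le fun s hs => ?_
    rw [Finset.mem_shatterer] at hs
    by_contra! hlt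
    refine h (fun i => s.equivFin.symm (Fin.castLE hlt.le i)) fun S => ?_
    have hinj : Function.Injective fun i : Fin d => (s.equivFin.symm (Fin.castLE hlt.le i) : ι) :=
      Subtype.val_injective.comp (s.equivFin.symm.injective.comp (Fin.castLE_injective hlt.le))
    classical
    let t : Finset ι := (Finset.univ.filter (· ∈ S)).image
      fun i : Fin d => (s.equivFin.symm (Fin.castLE hlt.le i) : ι)
    have hts : t ⊆ s := Finset.image_subset_iff.2 fun i _ => Subtype.prop _
    obtain ⟨u, hu, hsu⟩ := hs hts
    refine ⟨⟨u, hu⟩, fun i => ?_⟩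
    have h1 : (s.equivFin.symm (Fin.castLE hlt.le i) : ι) ∈ u ↔
        (s.equivFin.symm (Fin.castLE hlt.le i) : ι) ∈ t := by
      rw [← hsu, Finset.mem_inter]
      exact ⟨fun h => ⟨Subtype.prop _, h⟩, fun h => h.2⟩
    refine h1.trans ?_
    simp only [t, Finset.mem_image, Finset.mem_filter, Finset.mem_univ, true_and]
    exact ⟨fun ⟨j, hj, e⟩ => hinj e ▸ hj, fun hi => ⟨i, hi, rfl⟩⟩
  calc 𝒜.card ≤ ∑ k ∈ Finset.Iic 𝒜.vcDim, (Fintype.card ι).choose k :=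
        𝒜.card_le_card_shatterer.trans Finset.card_shatterer_le_sum_vcDim
    _ ≤ ∑ k ∈ Finset.range (d + 1), (Fintype.card ι).choose k :=
        Finset.sum_le_sum_of_subset fun k hk => by
          rw [Finset.mem_Iic] at hk
          rw [Finset.mem_range]
          omega
    -- The factors `d.choose k ≥ 1` complete the binomial expansion of `(Fintype.card ι + 1) ^ d`.
    _ ≤ ∑ k ∈ Finset.range (d + 1), Fintype.card ι ^ k * 1 ^ (d - k) * d.choose k :=
        Finset.sum_le_sum fun k hk => by
          rw [one_pow, mul_one]
          have : 0 < d.choose k := Nat.choose_pos (Nat.lt_succ_iff.1 (Finset.mem_range.1 hk))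
          exact (Nat.choose_le_pow _ _).trans (Nat.le_mul_of_pos_right _ this)
    _ = (Fintype.card ι + 1) ^ d := (add_pow _ _ _).symm

theorem exists_pow_lt_two_pow (e : ℕ) : ∃ N : ℕ, 0 < N ∧ (N + 1) ^ e < 2 ^ N := by
  have h := tendsto_pow_const_div_const_pow_of_one_lt e (one_lt_two (α := ℝ))
  obtain ⟨n, hn, hn'⟩ := ((h.eventually (gt_mem_nhds (show (0 : ℝ) < 1 / 2 by norm_num))).and
    (Filter.eventually_ge_atTop 2)).exists
  obtain ⟨N, rfl⟩ : ∃ N, n = N + 1 := ⟨n - 1, by omega⟩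
  refine ⟨N, by omega, ?_⟩
  rw [div_lt_iff₀ (by positivity), pow_succ] at hn
  have h2 : ((N + 1 : ℕ) : ℝ) ^ e < 2 ^ N := by linarith
  exact_mod_cast h2

/-- If `R` on `(α × γ) × β` shatters arbitrarily large finite families, then so does `R` as a
relation on `γ × (α × β)`, or one of the relations on `α × β ^ k` which express that a given
pattern is realized by an element of `γ`. -/
theorem exists_not_shattered (R : α × γ → β → Prop) (k d : ℕ)
    (hk : ∀ q : Fin k → α × β, ¬ Shattered (fun c (q : α × β) => R (q.1, c) q.2) q)
    (hd : ∀ (T : Finset (Fin k)) (y : Fin d → Fin k → β),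
      ¬ Shattered (fun a (y : Fin k → β) => ∃ c, ∀ i, R (a, c) (y i) ↔ i ∈ T) y) :
    ∃ N, ∀ y : Fin N → β, ¬ Shattered R y := by
  classical
  -- The summand `k` bounds the fibres of `τ` below; the other bounds its image, with `(k + 1) * d`
  -- for each of the `2 ^ k` patterns. Together they leave fewer than `2 ^ N` subsets of `Fin N`.
  obtain ⟨N, hN0, hN⟩ := exists_pow_lt_two_pow (k + (k + 1) * d * 2 ^ k)
  refine ⟨N, fun y hy => ?_⟩
  choose g hg using fun s : Finset (Fin N) => hy s
  let Q (T : Finset (Fin k)) (a : α) (u : Fin k → Fin N) : Prop :=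
    ∃ c, ∀ i, R (a, c) (y (u i)) ↔ i ∈ T
  -- `τ s` records which patterns can be realized on which `k`-tuples when the first coordinate is
  -- that of `g s`. Within a fibre first coordinates are interchangeable, so a `k`-tuple shattered
  -- by a fibre contradicts `hk`; `d` tuples shattered by the values of `τ` at one pattern
  -- contradict `hd`.
  let τ (s : Finset (Fin N)) (T : Finset (Fin k)) : Finset (Fin k → Fin N) :=
    Finset.univ.filter fun u => Q T (g s).1 u
  have hfib : ∀ r ∈ Finset.univ.image τ, (Finset.univ.filter fun s => τ s = r).card ≤
      (N + 1) ^ k := by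
    intro r hr
    obtain ⟨s₀, -, rfl⟩ := Finset.mem_image.1 hr
    refine (card_le_of_not_shattered _ k fun e he => ?_).trans_eq (by rw [Fintype.card_fin])
    refine hk (fun i => ((g s₀).1, y (e i))) fun T => ?_
    obtain ⟨⟨s, hs⟩, hsT⟩ := he T
    have h1 : e ∈ τ s (Finset.univ.filter (· ∈ T)) := by
      refine Finset.mem_filter.2 ⟨Finset.mem_univ _, (g s).2, fun i => ?_⟩
      simpa using (hg s (e i)).trans (hsT i)
    rw [(Finset.mem_filter.1 hs).2] at h1
    obtain ⟨c, hc⟩ := (Finset.mem_filter.1 h1).2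
    exact ⟨c, fun i => by simpa using hc i⟩
  have himg : (Finset.univ.image τ).card ≤ (N + 1) ^ ((k + 1) * d * 2 ^ k) := by
    have h1 : ∀ T, (Finset.univ.image fun s => τ s T).card ≤ (N + 1) ^ ((k + 1) * d) := by
      intro T
      refine (card_le_of_not_shattered _ d fun e he => hd T (fun i => y ∘ e i) fun S => ?_).trans ?_
      · obtain ⟨⟨_, hs⟩, hsS⟩ := he S
        obtain ⟨s, -, rfl⟩ := Finset.mem_image.1 hs
        exact ⟨(g s).1, fun i => by simpa [τ, Q] using hsS i⟩
      · rw [pow_mul]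
        refine Nat.pow_le_pow_left ?_ d
        rw [Fintype.card_pi_const, Fintype.card_fin, pow_succ]
        have h2 : N ^ k ≤ (N + 1) ^ k := Nat.pow_le_pow_left (Nat.le_succ N) k
        have h3 : 1 ≤ (N + 1) ^ k := Nat.one_le_pow _ _ (Nat.succ_pos N)
        nlinarith
    calc (Finset.univ.image τ).card
        ≤ (Fintype.piFinset fun T => Finset.univ.image fun s => τ s T).card :=
          Finset.card_le_card fun r hr => by
            obtain ⟨s, -, rfl⟩ := Finset.mem_image.1 hr
            exact Fintype.mem_piFinset.2 fun T => Finset.mem_image_of_mem _ (Finset.mem_univ s)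
      _ = ∏ T : Finset (Fin k), (Finset.univ.image fun s => τ s T).card := Fintype.card_piFinset _
      _ ≤ ∏ T : Finset (Fin k), (N + 1) ^ ((k + 1) * d) := Finset.prod_le_prod' fun T _ => h1 T
      _ = (N + 1) ^ ((k + 1) * d * 2 ^ k) := by
          rw [Finset.prod_const, Finset.card_univ, Fintype.card_finset, Fintype.card_fin, ← pow_mul]
  have := Finset.card_le_mul_card_image (f := τ) Finset.univ _ hfib
  rw [Finset.card_univ, Fintype.card_finset, Fintype.card_fin] at this
  refine (this.trans (Nat.mul_le_mul_left _ himg)).not_gt ?_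
  rwa [← pow_add]

end Shattering

/-! ### The independence property -/

section Formulas

variable {L : FirstOrder.Language.{u, u}} {M : Type u} [L.Structure M]

/-- The relation defined by a formula in two tuples of variables. -/
def formulaRel (M : Type u) [L.Structure M] {α β : Type*} (φ : L.Formula (α ⊕ β)) :
    (α → M) → (β → M) → Prop :=
  fun b a => φ.Realize (Sum.elim b a)

theorem hasIP_iff {m n : ℕ} {φ : L.Formula (Fin m ⊕ Fin n)} :
    HasIP M φ ↔ ∀ k, ∃ y : Fin k → Fin n → M, Shattered (formulaRel M φ) y := by
  refine forall_congr' fun k => exists_congr fun a => ?_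
  exact ⟨fun ⟨b, hb⟩ S => ⟨b S, fun i => hb i S⟩, fun h => by
    choose b hb using h
    exact ⟨b, fun i S => hb S i⟩⟩

theorem hasIP_relabel {m : ℕ} {β : Type} [Finite β] (φ : L.Formula (Fin m ⊕ β))
    (h : ∀ k, ∃ y : Fin k → β → M, Shattered (formulaRel M φ) y) :
    ∃ (n : ℕ) (ψ : L.Formula (Fin m ⊕ Fin n)), HasIP M ψ := by
  obtain ⟨n, ⟨e⟩⟩ := Finite.exists_equiv_fin β
  refine ⟨n, φ.relabel (Sum.map id e), hasIP_iff.2 fun k => ?_⟩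
  obtain ⟨y, hy⟩ := h k
  refine ⟨_, hy.map id (fun a => a ∘ e.symm) fun b a => ?_⟩
  simp only [formulaRel, Language.Formula.realize_relabel]
  refine iff_of_eq (congrArg _ (funext fun i => ?_))
  rcases i with i | i <;> simp

open Classical in
/-- The formula expressing that `φ(x, yᵢ)` holds exactly for the indices `i ∈ S`, for some `x`. -/
noncomputable def patternFormula {α β γ ι : Type*} [Finite α] [Finite ι] (φ : L.Formula (α ⊕ β))
    (f : ι → β → γ) (S : Set ι) : L.Formula γ :=
  Language.Formula.iExs α (Language.Formula.iInf fun i : ι =>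
    let ψ : L.Formula (γ ⊕ α) := φ.relabel (Sum.elim Sum.inr fun j => Sum.inl (f i j))
    if i ∈ S then ψ else ψ.not)

theorem realize_patternFormula {α β γ ι : Type*} [Finite α] [Finite ι] {φ : L.Formula (α ⊕ β)}
    {f : ι → β → γ} {S : Set ι} {v : γ → M} :
    (patternFormula φ f S).Realize v ↔ ∃ b, ∀ i, formulaRel M φ b (fun j => v (f i j)) ↔ i ∈ S := by
  simp only [patternFormula, Language.Formula.realize_iExs, Language.Formula.realize_iInf]
  refine exists_congr fun b => forall_congr' fun i => ?_
  have h : (φ.relabel (Sum.elim Sum.inr fun j => Sum.inl (f i j)) : L.Formula (γ ⊕ α)).Realize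
      (Sum.elim v b) ↔ formulaRel M φ b (fun j => v (f i j)) := by
    rw [Language.Formula.realize_relabel, formulaRel]
    refine iff_of_eq (congrArg _ (funext fun x => ?_))
    rcases x with x | x <;> rfl
  by_cases hi : i ∈ S <;> simp [hi, h]

/-- The formula expressing that a family is shattered. -/
noncomputable def shatteredFormula {α β γ ι : Type*} [Finite α] [Finite ι] (φ : L.Formula (α ⊕ β))
    (f : ι → β → γ) : L.Formula γ :=
  Language.Formula.iInf fun S : Set ι => patternFormula φ f S

theorem realize_shatteredFormula {α β γ ι : Type*} [Finite α] [Finite ι] {φ : L.Formula (α ⊕ β)}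
    {f : ι → β → γ} {v : γ → M} :
    (shatteredFormula φ f).Realize v ↔ Shattered (formulaRel M φ) fun i j => v (f i j) := by
  simp only [shatteredFormula, Language.Formula.realize_iInf, realize_patternFormula, Shattered]

/-- The last variable is split off. The relations in `exists_not_shattered` are definable: the other
variables become parameters, or the last one is quantified away by `patternFormula`. -/
theorem exists_hasIP_of_succ {m n : ℕ} (φ : L.Formula (Fin (m + 1) ⊕ Fin n)) (hφ : HasIP M φ) :
    (∃ (n' : ℕ) (ψ : L.Formula (Fin 1 ⊕ Fin n')), HasIP M ψ) ∨
      ∃ (n' : ℕ) (ψ : L.Formula (Fin m ⊕ Fin n')), HasIP M ψ := by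
  by_contra! hno
  obtain ⟨h1, h2⟩ := hno
  let R : (Fin m → M) × (Fin 1 → M) → (Fin n → M) → Prop := fun q y =>
    formulaRel M φ (Fin.append q.1 q.2) y
  obtain ⟨k, hk⟩ : ∃ k, ∀ q : Fin k → (Fin m → M) × (Fin n → M),
      ¬ Shattered (fun c (q : (Fin m → M) × (Fin n → M)) => R (q.1, c) q.2) q := by
    by_contra! h
    let ψ : L.Formula (Fin 1 ⊕ (Fin m ⊕ Fin n)) := φ.relabel (Sum.elim
      (Fin.append (fun i => Sum.inr (Sum.inl i)) (fun i => Sum.inl i)) fun j => Sum.inr (Sum.inr j))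
    obtain ⟨n', ψ', hψ'⟩ := hasIP_relabel (M := M) ψ fun k => by
      obtain ⟨q, hq⟩ := h k
      refine ⟨_, hq.map id (fun q => Sum.elim q.1 q.2) fun c q => ?_⟩
      simp only [formulaRel, R, ψ, Language.Formula.realize_relabel]
      refine iff_of_eq (congrArg _ (funext fun i => ?_))
      rcases i with i | i
      · refine Fin.addCases (fun i => ?_) (fun i => ?_) i <;> simp
      · simp
    exact h1 _ _ hψ'
  have hT : ∀ T : Finset (Fin k), ∃ d, ∀ y : Fin d → Fin k → Fin n → M,
      ¬ Shattered (fun a (y : Fin k → Fin n → M) => ∃ c, ∀ i, R (a, c) (y i) ↔ i ∈ T) y := by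
    intro T
    by_contra! h
    let φ' : L.Formula (Fin 1 ⊕ (Fin m ⊕ Fin n)) := φ.relabel (Sum.elim
      (Fin.append (fun i => Sum.inr (Sum.inl i)) (fun i => Sum.inl i)) fun j => Sum.inr (Sum.inr j))
    let ψ : L.Formula (Fin m ⊕ (Fin k × Fin n)) := patternFormula φ'
      (fun i => Sum.elim (fun j => Sum.inl j) fun j => Sum.inr (i, j)) (T : Set (Fin k))
    obtain ⟨n', ψ', hψ'⟩ := hasIP_relabel (M := M) ψ fun d => by
      obtain ⟨y, hy⟩ := h d
      refine ⟨_, hy.map id (fun y q => y q.1 q.2) fun a y => ?_⟩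
      rw [formulaRel, realize_patternFormula]
      refine exists_congr fun c => forall_congr' fun i => iff_congr ?_ Iff.rfl
      simp only [formulaRel, R, φ', Language.Formula.realize_relabel]
      refine iff_of_eq (congrArg _ (funext fun i => ?_))
      rcases i with i | i
      · refine Fin.addCases (fun i => ?_) (fun i => ?_) i <;> simp
      · simp
    exact h2 _ _ hψ'
  choose d hd using hT
  obtain ⟨N, hN⟩ := exists_not_shattered R k (∑ T, d T) hk fun T y hy =>
    hd T _ (hy.comp (Fin.castLE_injective (Finset.single_le_sum (f := d) (fun _ _ => Nat.zero_le _)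
      (Finset.mem_univ T))))
  obtain ⟨y, hy⟩ := hasIP_iff.1 hφ N
  refine hN _ (hy.map (fun b => (fun i => b (Fin.castAdd 1 i), fun i => b (Fin.natAdd m i))) id
    fun b y => ?_)
  have : Fin.append (fun i => b (Fin.castAdd 1 i)) (fun i => b (Fin.natAdd m i)) = b :=
    Fin.append_castAdd_natAdd
  simp only [R, id, this]

/-- If some formula has the independence property, then some formula `φ(x, y)` with `x` a single
variable has it (a theorem of Shelah). -/
theorem exists_hasIP_one {m n : ℕ} (φ : L.Formula (Fin m ⊕ Fin n)) (hφ : HasIP M φ) :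
    ∃ (n' : ℕ) (ψ : L.Formula (Fin 1 ⊕ Fin n')), HasIP M ψ := by
  induction m generalizing n with
  | zero =>
    obtain ⟨a, b, h⟩ := hφ 1
    have := (h 0 Set.univ).2 trivial
    rw [Subsingleton.elim (b Set.univ) (b ∅)] at this
    exact absurd ((h 0 ∅).1 this) (Set.notMem_empty _)
  | succ m ih =>
    rcases exists_hasIP_of_succ φ hφ with h | ⟨n', ψ, hψ⟩
    exacts [h, ih ψ hψ]

/-- For each `k`, the existence of `k` shattered tuples is a single sentence. -/
theorem HasIP.of_isComplete {T : L.Theory} (hT : T.IsComplete) {C : Type u} [L.Structure C]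
    [Nonempty C] [C ⊨ T] [Nonempty M] [M ⊨ T] {m n : ℕ} {φ : L.Formula (Fin m ⊕ Fin n)}
    (hφ : HasIP M φ) : HasIP C φ := by
  rw [hasIP_iff] at hφ ⊢
  intro k
  let χ : L.Sentence := Language.Formula.iExs (Fin k × Fin n)
    (shatteredFormula φ fun i j => (Sum.inr (i, j) : Empty ⊕ (Fin k × Fin n)))
  have hχ : ∀ (N : Type u) [L.Structure N],
      (N ⊨ χ) ↔ ∃ y : Fin k → Fin n → N, Shattered (formulaRel N φ) y := by
    intro N _
    refine Language.Formula.realize_iExs.trans ?_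
    simp only [realize_shatteredFormula, Sum.elim_inr]
    exact ⟨fun ⟨y, hy⟩ => ⟨fun i j => y (i, j), hy⟩, fun ⟨y, hy⟩ => ⟨fun q => y q.1 q.2, hy⟩⟩
  rw [← hχ, hT.realize_sentence_iff χ C, ← hT.realize_sentence_iff χ M, hχ]
  exact hφ k

end Formulas

/-! ### Types in theories with the independence property -/

section Saturation

variable {L : FirstOrder.Language.{u, u}} {C : Type u} [L.Structure C] {θ : Cardinal.{u}}

theorem IsSaturated.exists_realize (hC : IsSaturated L C (Order.succ θ)) (A : Set C) (hA : #A ≤ θ)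
    {n : ℕ} {ι : Type*} (χ : ι → L.Formula (A ⊕ Fin n))
    (h : ∀ s : Finset ι, ∃ v : Fin n → C, ∀ i ∈ s,
      (χ i).Realize (Sum.elim (fun a : A => (a : C)) v)) :
    ∃ v : Fin n → C, ∀ i, (χ i).Realize (Sum.elim (fun a : A => (a : C)) v) := by
  classical
  let χ' : ι → L[[A]].Formula (Fin n) := fun i => Language.BoundedFormula.constantsVarsEquiv.symm (χ i)
  have hχ : ∀ i (v : Fin n → C), (χ' i).Realize v ↔
      (χ i).Realize (Sum.elim (fun a : A => (a : C)) v) := by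
    intro i v
    have := Language.BoundedFormula.realize_constantsVarsEquiv (L := L) (α := A) (M := C)
      (φ := χ' i) (v := v) (xs := default)
    simp only [χ', Equiv.apply_symm_apply, Language.coe_con] at this
    exact this.symm
  obtain ⟨v, hv⟩ := hC A (Order.lt_succ_of_le hA) n (Set.range χ') fun s hs => by
    obtain ⟨t, -, rfl⟩ := Finset.subset_set_image_iff.1 (hs.trans_eq Set.image_univ.symm)
    obtain ⟨v, hv⟩ := h t
    refine ⟨v, fun φ hφ => ?_⟩
    obtain ⟨i, hi, rfl⟩ := Finset.mem_image.1 hφ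
    exact (hχ i v).2 (hv i hi)
  exact ⟨v, fun i => (hχ i v).1 (hv _ ⟨i, rfl⟩)⟩

/-- The set of elements occurring in a set of tuples. -/
def coordinates {n : ℕ} (Z : Set (Fin n → C)) : Set C := ⋃ z : Z, Set.range (z : Fin n → C)

theorem mem_coordinates {n : ℕ} {Z : Set (Fin n → C)} (z : Z) (j : Fin n) :
    (z : Fin n → C) j ∈ coordinates Z := Set.mem_iUnion.2 ⟨z, j, rfl⟩

theorem card_coordinates_le (hθ : ℵ₀ ≤ θ) {n : ℕ} {Z : Set (Fin n → C)} (hZ : #Z ≤ θ) :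
    #(coordinates Z) ≤ θ :=
  mk_iUnion_le_sum_mk.trans ((sum_le_mk_mul_iSup _).trans ((mul_le_mul' hZ (ciSup_le' fun _ =>
    (Set.finite_range _).lt_aleph0.le.trans hθ)).trans (mul_eq_self hθ).le))

/-- Every finite subset of `Z` extends, by any finite number of tuples, to a family shattered
by `φ`. -/
def IsExtendable {n : ℕ} (φ : L.Formula (Fin 1 ⊕ Fin n)) (Z : Set (Fin n → C)) : Prop :=
  ∀ F : Finset (Fin n → C), ↑F ⊆ Z → ∀ e : ℕ, ∃ w : Fin e → Fin n → C,
    Shattered (formulaRel C φ) (Sum.elim (fun z : F => (z : Fin n → C)) w)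

theorem IsExtendable.exists_insert {n : ℕ} {φ : L.Formula (Fin 1 ⊕ Fin n)} {Z : Set (Fin n → C)}
    (hC : IsSaturated L C (Order.succ θ)) (hθ : ℵ₀ ≤ θ) (h : IsExtendable φ Z) (hZ : #Z ≤ θ) :
    ∃ y ∉ Z, IsExtendable φ (insert y Z) := by
  classical
  let A := coordinates Z
  let χ (q : {F : Finset (Fin n → C) // ↑F ⊆ Z} × ℕ) : L.Formula (A ⊕ Fin n) :=
    Language.Formula.iExs (Fin q.2 × Fin n) <| shatteredFormula φ <|
      Sum.elim (fun (z : q.1.1) j => Sum.inl (Sum.inl ⟨z.1 j, mem_coordinates ⟨z.1, q.1.2 z.2⟩ j⟩))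
        (Fin.cons (fun j => Sum.inl (Sum.inr j)) fun (i : Fin q.2) j => Sum.inr (i, j))
  have hχ : ∀ q (y : Fin n → C), (χ q).Realize (Sum.elim (fun a : A => (a : C)) y) ↔
      ∃ w : Fin q.2 → Fin n → C, Shattered (formulaRel C φ)
        (Sum.elim (fun z : q.1.1 => (z : Fin n → C)) (Fin.cons y w : Fin (q.2 + 1) → Fin n → C)) := by
    intro q y
    have key : ∀ w : Fin q.2 × Fin n → C, (fun i j => Sum.elim (Sum.elim (fun a : A => (a : C)) y) w
        (Sum.elim (fun (z : q.1.1) j => Sum.inl (Sum.inl ⟨z.1 j, mem_coordinates ⟨z.1, q.1.2 z.2⟩ j⟩))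
          (Fin.cons (fun j => Sum.inl (Sum.inr j)) fun (i : Fin q.2) j => Sum.inr (i, j) :
            Fin (q.2 + 1) → Fin n → (A ⊕ Fin n) ⊕ (Fin q.2 × Fin n)) i j)) =
        Sum.elim (fun z : q.1.1 => (z : Fin n → C))
          (Fin.cons y fun i j => w (i, j) : Fin (q.2 + 1) → Fin n → C) := by
      intro w
      funext i j
      rcases i with i | i
      · rfl
      · refine Fin.cases ?_ (fun i => ?_) i <;> rfl
    refine Language.Formula.realize_iExs.trans ?_
    simp only [realize_shatteredFormula, key]
    exact ⟨fun ⟨w, hw⟩ => ⟨fun i j => w (i, j), hw⟩, fun ⟨w, hw⟩ => ⟨fun q => w q.1 q.2, hw⟩⟩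
  -- Finitely many conditions on `y` follow from extending the union of their finite sets by enough
  -- tuples; the first new tuple serves as `y`.
  obtain ⟨y, hy⟩ := hC.exists_realize A (card_coordinates_le hθ hZ) χ fun s => by
    obtain ⟨W, hW⟩ := h (s.biUnion fun q => q.1.1) (by
      intro z hz
      obtain ⟨q, -, hz⟩ := Finset.mem_biUnion.1 hz
      exact q.1.2 hz) ((∑ q ∈ s, q.2) + 1)
    refine ⟨W 0, fun q hq => (hχ q _).2 ?_⟩
    have hle : q.2 + 1 ≤ (∑ q ∈ s, q.2) + 1 := Nat.succ_le_succ
      (Finset.single_le_sum (f := fun q => q.2) (fun _ _ => Nat.zero_le _) hq)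
    have hsub : q.1.1 ⊆ s.biUnion fun q => q.1.1 :=
      Finset.subset_biUnion_of_mem (fun q => q.1.1) hq
    have hW' := hW.comp (f := Sum.map (fun z : q.1.1 => ⟨z.1, hsub z.2⟩) (Fin.castLE hle))
      (Sum.map_injective.2 ⟨fun z z' e => Subtype.ext (congrArg (fun x => x.1) e),
        Fin.castLE_injective hle⟩)
    refine ⟨fun i => W (Fin.castLE hle i.succ), ?_⟩
    convert! hW' using 1
    funext i
    rcases i with i | i
    · rfl
    · refine Fin.cases ?_ (fun i => ?_) i <;> rfl
  have hy' : ∀ F : Finset (Fin n → C), ↑F ⊆ Z → ∀ e : ℕ, ∃ w : Fin e → Fin n → C,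
      Shattered (formulaRel C φ) (Sum.elim (fun z : F => (z : Fin n → C))
        (Fin.cons y w : Fin (e + 1) → Fin n → C)) := fun F hF e => (hχ (⟨F, hF⟩, e) y).1 (hy _)
  -- Shattered families are injective, so `y` cannot repeat an element of `Z`.
  have hyZ : y ∉ Z := fun hyZ => by
    obtain ⟨w, hw⟩ := hy' {y} (by simpa using hyZ) 0
    exact Sum.inl_ne_inr (hw.injective (a₁ := Sum.inl ⟨y, Finset.mem_singleton_self y⟩)
      (a₂ := Sum.inr 0) rfl)
  refine ⟨y, hyZ, fun F hF e => ?_⟩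
  obtain ⟨w, hw⟩ := hy' (F.erase y) (fun z hz => by
    obtain ⟨h1, h2⟩ := Finset.mem_erase.1 hz
    exact (hF h2).resolve_left h1) e
  let f : F ⊕ Fin e → F.erase y ⊕ Fin (e + 1) := Sum.elim
    (fun z => if hz : z.1 = y then Sum.inr 0 else Sum.inl ⟨z.1, Finset.mem_erase.2 ⟨hz, z.2⟩⟩)
    fun i => Sum.inr i.succ
  have hfam : Sum.elim (fun z : F => (z : Fin n → C)) w =
      Sum.elim (fun z : F.erase y => (z : Fin n → C)) (Fin.cons y w : Fin (e + 1) → Fin n → C) ∘ f := by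
    funext i
    rcases i with z | i
    · by_cases hz : z.1 = y <;> simp [f, hz]
    · rfl
  have hinj : Function.Injective f := by
    rintro (z | i) (z' | i') heq
    · by_cases hz : z.1 = y <;> by_cases hz' : z'.1 = y <;> simp [f, hz, hz'] at heq
      · exact congrArg Sum.inl (Subtype.ext (hz.trans hz'.symm))
      · exact congrArg Sum.inl heq
    · by_cases hz : z.1 = y <;> simp [f, hz] at heq
      exact absurd heq.symm (Fin.succ_ne_zero i')
    · by_cases hz : z'.1 = y <;> simp [f, hz] at heq
    · simpa [f] using heq
  exact ⟨w, hfam ▸ hw.comp hinj⟩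

/-- Extendability has finite character, so Zorn applies, and `IsExtendable.exists_insert` makes a
maximal set large. Shattering alone would not suffice: a finite shattered set need not extend to a
larger one. -/
theorem exists_isExtendable {n : ℕ} {φ : L.Formula (Fin 1 ⊕ Fin n)} (hφ : HasIP C φ)
    (hC : IsSaturated L C (Order.succ θ)) (hθ : ℵ₀ ≤ θ) :
    ∃ Z : Set (Fin n → C), #Z = θ ∧ IsExtendable φ Z := by
  have h0 : IsExtendable φ (∅ : Set (Fin n → C)) := fun F hF e => by
    obtain ⟨y, hy⟩ := hasIP_iff.1 hφ e
    obtain rfl : F = ∅ := by simpa using hF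
    refine ⟨y, fun S => ?_⟩
    obtain ⟨b, hb⟩ := hy (Sum.inr ⁻¹' S)
    exact ⟨b, Sum.rec (fun z => absurd z.2 (Finset.notMem_empty _)) hb⟩
  obtain ⟨Z, -, hZ⟩ := zorn_subset_nonempty {Z : Set (Fin n → C) | IsExtendable φ Z} (by
    intro c hc hchain hne
    refine ⟨⋃₀ c, fun F hF => ?_, fun s => Set.subset_sUnion_of_mem⟩
    obtain ⟨Z, hZ, hFZ⟩ := hchain.directedOn.exists_mem_subset_of_finite_of_subset_sUnion hne
      F.finite_toSet hF
    exact hc hZ F hFZ) ∅ h0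
  have hle : θ ≤ #Z := by
    by_contra! hlt
    obtain ⟨y, hy, hins⟩ := IsExtendable.exists_insert hC hθ hZ.prop hlt.le
    exact hy (hZ.le_of_ge hins (Set.subset_insert y Z) (Set.mem_insert y Z))
  obtain ⟨Z₀, hZ₀, hcard⟩ := le_mk_iff_exists_subset.1 hle
  exact ⟨Z₀, hcard, fun F hF => hZ.prop F (hF.trans hZ₀)⟩

theorem IsExtendable.exists_realize {n : ℕ} {φ : L.Formula (Fin 1 ⊕ Fin n)} {Z : Set (Fin n → C)}
    (hC : IsSaturated L C (Order.succ θ)) (hθ : ℵ₀ ≤ θ) (h : IsExtendable φ Z) (hZ : #Z ≤ θ)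
    (S : Set Z) : ∃ b : Fin 1 → C, ∀ z : Z, formulaRel C φ b z ↔ z ∈ S := by
  classical
  let A := coordinates Z
  let ψ (z : Z) : L.Formula (A ⊕ Fin 1) :=
    φ.relabel (Sum.elim Sum.inr fun j => Sum.inl ⟨z.1 j, mem_coordinates z j⟩)
  have hψ : ∀ z (b : Fin 1 → C), (ψ z).Realize (Sum.elim (fun a : A => (a : C)) b) ↔
      formulaRel C φ b z := by
    intro z b
    rw [Language.Formula.realize_relabel, formulaRel]
    refine iff_of_eq (congrArg _ (funext fun x => ?_))
    rcases x with x | x <;> rfl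
  have hlit : ∀ z (b : Fin 1 → C), (if z ∈ S then ψ z else (ψ z).not).Realize
      (Sum.elim (fun a : A => (a : C)) b) ↔ (formulaRel C φ b z ↔ z ∈ S) := by
    intro z b
    by_cases hz : z ∈ S <;> simp [hz, hψ]
  obtain ⟨b, hb⟩ := hC.exists_realize A (card_coordinates_le hθ hZ)
    (fun z : Z => if z ∈ S then ψ z else (ψ z).not) fun s => by
      obtain ⟨w, hw⟩ := h (s.image Subtype.val) (by simp) 0
      obtain ⟨b, hb⟩ := hw {i | ∃ z ∈ S, (Sum.elim (fun z : s.image Subtype.val => z.1) w i) = z.1}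
      refine ⟨b, fun z hz => (hlit z b).2 ?_⟩
      refine (hb (Sum.inl ⟨z, Finset.mem_image_of_mem _ hz⟩)).trans ?_
      exact ⟨fun ⟨z', hz', e⟩ => (Subtype.ext e : z = z') ▸ hz', fun hz => ⟨z, hz, rfl⟩⟩
  exact ⟨b, fun z => (hlit z b).1 (hb z)⟩

end Saturation

/-! ### Counting Boolean types under IP -/

section Counting

variable {L : FirstOrder.Language.{u, u}} {C : Type u} [L.Structure C] {X B : Type u}
  [BooleanAlgebra B] {θ : Cardinal.{u}}

/-- The complete type of a tuple, as a Boolean type with values `⊥` and `⊤`. -/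
noncomputable def typeOf (A : Set C) (B : Type u) [BooleanAlgebra B] (v : X → C) : BType L A X B := by
  classical
  exact
  { toFun := fun D => if v ∈ D then ⊤ else ⊥
    map_sup' := fun D E => by
      by_cases h1 : v ∈ D <;> by_cases h2 : v ∈ E <;> simp [h1, h2]
    map_inf' := fun D E => by
      by_cases h1 : v ∈ D <;> by_cases h2 : v ∈ E <;> simp [h1, h2]
    map_top' := by simp
    map_bot' := by simp }

theorem typeOf_eq_top_iff [Nontrivial B] {A : Set C} {v : X → C} {D : L.DefinableSet A X} :
    (typeOf A B v : BType L A X B) D = ⊤ ↔ v ∈ D := by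
  classical
  have : (typeOf A B v : BType L A X B) D = if v ∈ D then ⊤ else ⊥ := by
    simp only [typeOf]
    congr
  rw [this]
  by_cases h : v ∈ D <;> simp [h]

theorem card_definableSet_le (hL : max ℵ₀ L.card ≤ θ) (hX : #X ≤ θ) {A : Set C} (hA : #A ≤ θ) :
    #(L.DefinableSet A X) ≤ θ := by
  have hθ : ℵ₀ ≤ θ := (le_max_left _ _).trans hL
  have hcover : (Set.univ : Set (L.DefinableSet A X)) ⊆ ⋃ q : FormulaIndex L X,
      Set.range (instanceSet (A := A) q.2.2.1 q.2.2.2) := fun D _ => by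
    obtain ⟨q, a, rfl⟩ := exists_eq_instanceSet D
    exact Set.mem_iUnion.2 ⟨q, a, rfl⟩
  rw [← mk_univ]
  exact (mk_le_mk_of_subset hcover).trans (mk_iUnion_le_sum_mk.trans ((sum_le_mk_mul_iSup _).trans
    ((mul_le_mul' (card_formulaIndex_le hL hX) (ciSup_le' fun q =>
      mk_range_le.trans (card_fin_arrow_le hθ hA _))).trans (mul_eq_self hθ).le)))

theorem card_bType_le (hL : max ℵ₀ L.card ≤ θ) (hX : #X ≤ θ) {A : Set C} (hA : #A ≤ θ) :
    #(BType L A X B) ≤ #B ^ θ := by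
  have h : #(BType L A X B) ≤ #(L.DefinableSet A X → B) := mk_le_of_injective DFunLike.coe_injective
  refine h.trans ?_
  rw [← power_def]
  exact power_le_power_left (mk_ne_zero B) (card_definableSet_le hL hX hA)

theorem card_imageConjClasses_le_card_bType (A : Set C) :
    #(ImageConjClasses L A X B) ≤ #(BType L A X B) := mk_quotient_le

/-- Conjugation preserves which definable sets get value `⊤`, so for nontrivial `B` tuples cutting
out different subsets of `Z` have non-conjugate types. Since `φ` has one object variable, any
nonempty `X` works, with all its variables given the same value. -/
theorem exists_power_le_card_imageConjClasses {n : ℕ} {φ : L.Formula (Fin 1 ⊕ Fin n)}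
    (hφ : HasIP C φ) (hC : IsSaturated L C (Order.succ θ)) (hθ : ℵ₀ ≤ θ) (hB : #B ≤ θ)
    [Nonempty X] : ∃ A : Set C, #A ≤ θ ∧ #B ^ θ ≤ #(ImageConjClasses L A X B) := by
  obtain ⟨Z, hZ, hext⟩ := exists_isExtendable hφ hC hθ
  refine ⟨coordinates Z, card_coordinates_le hθ hZ.le, ?_⟩
  rcases subsingleton_or_nontrivial B with hsub | hnt
  · have : Nonempty C := by
      obtain ⟨-, b, -⟩ := hφ 0
      exact ⟨b ∅ 0⟩
    have : Nonempty (ImageConjClasses L (coordinates Z) X B) :=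
      ⟨Quotient.mk _ (typeOf _ B fun _ => Classical.arbitrary C)⟩
    have h1 : #B = 1 := by
      rw [eq_one_iff_unique]
      exact ⟨hsub, ⟨⊥⟩⟩
    rw [h1, one_power]
    exact Cardinal.one_le_iff_ne_zero.2 (mk_ne_zero _)
  choose b hb using hext.exists_realize hC hθ hZ.le
  let D (z : Z) : L.DefinableSet (coordinates Z) X := instanceSet φ
    (fun _ => Classical.arbitrary X) fun j => ⟨z.1 j, mem_coordinates z j⟩
  have hD : ∀ S z, (fun _ => b S 0) ∈ D z ↔ z ∈ S := by
    intro S z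
    rw [← hb, mem_instanceSet, formulaRel]
    refine iff_of_eq (congrArg _ (congrArg (fun c => Sum.elim c _) (funext fun i => ?_)))
    rw [Subsingleton.elim i 0]
    rfl
  have hB2 : #B ^ θ = 2 ^ θ := by
    refine le_antisymm ?_ (power_le_power_right (two_le_iff.2 (exists_pair_ne B)))
    refine (power_le_power_right (hB.trans (cantor θ).le)).trans_eq ?_
    rw [← power_mul, mul_eq_self hθ]
  calc #B ^ θ = #(Set Z) := by rw [hB2, mk_set, hZ]
    _ ≤ #(ImageConjClasses L (coordinates Z) X B) :=
      mk_le_of_injective (f := fun S => Quotient.mk _ (typeOf _ B fun _ => b S 0)) fun S S' h => by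
        have h1 := (imageConj_iff _ _).1 (Quotient.exact h)
        ext z
        have h2 := h1 ⊤ (D z)
        rw [map_top, map_top, top_le_iff, top_le_iff, typeOf_eq_top_iff, typeOf_eq_top_iff, hD,
          hD] at h2
        exact h2

end Counting

end BooleanTypes

open BooleanTypes in
theorem mainTheorem11 {L : FirstOrder.Language.{u, u}} (T : L.Theory) (hT : T.IsComplete)
    (C : Type u) [L.Structure C] [Nonempty C] [C ⊨ T]
    (B : Type u) [CompleteBooleanAlgebra B] (X : Type u) :
    (∀ κ : Cardinal.{u}, κ.IsRegular → BooleanTypes.IsCC B κ →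
      ∀ A : Set C, ℵ₀ ≤ #A → ∀ μ : Cardinal.{u}, μ = (2 ^< κ) + max ℵ₀ L.card + #X →
        (BooleanTypes.IsStable T → #(BooleanTypes.ImageConjClasses L A X B) ≤ #A ^ μ) ∧
        (BooleanTypes.IsNIP T →
          #(BooleanTypes.ImageConjClasses L A X B) ≤ BooleanTypes.ded #A ^ μ)) ∧
    (¬ BooleanTypes.IsNIP T → Finite X → Nonempty X →
      ∀ θ : Cardinal.{u}, #B + max ℵ₀ L.card ≤ θ →
        BooleanTypes.IsSaturated L C (Order.succ θ) →
          IsLUB {c : Cardinal.{u} | ∃ A : Set C, #A ≤ θ ∧ c = #(BooleanTypes.BType L A X B)}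
            (#B ^ θ) ∧
          IsLUB {c : Cardinal.{u} | ∃ A : Set C, #A ≤ θ ∧
            c = #(BooleanTypes.ImageConjClasses L A X B)} (#B ^ θ)) := by
  refine ⟨fun κ hκ hB A hA μ hμ => ?_, fun hT' _ _ θ hθ hC => ?_⟩
  · have h1 : 2 ^< κ ≤ μ := hμ ▸ le_self_add.trans le_self_add
    have h2 : max ℵ₀ L.card ≤ μ := hμ ▸ le_add_self.trans le_self_add
    have h3 : #X ≤ μ := hμ ▸ le_add_self
    constructor
    · intro hst
      exact card_imageConjClasses_le_power hκ hB h1 h2 h3 hA (hst.isNIP C) fun q =>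
        card_range_trace_le hA _ (hst C _ _ _) (hst C _ _ _) _
    · intro hnip
      exact card_imageConjClasses_le_power hκ hB h1 h2 h3 (hA.trans (le_ded _)) (hnip C) fun q =>
        card_range_trace_le_ded hA _ (hnip C _ _ _) _
  · have hL : max ℵ₀ L.card ≤ θ := le_add_self.trans hθ
    have hθ0 : ℵ₀ ≤ θ := (le_max_left _ _).trans hL
    have hX : #X ≤ θ := mk_le_aleph0.trans hθ0
    -- The reduction to one variable is made in the model where IP occurs; the resulting formula is
    -- then transferred to `C`.
    obtain ⟨n, φ, hφ⟩ : ∃ (n : ℕ) (φ : L.Formula (Fin 1 ⊕ Fin n)), HasIP C φ := by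
      unfold IsNIP at hT'
      push Not at hT'
      obtain ⟨M, _, _, _, m, n, φ, hφ⟩ := hT'
      obtain ⟨n', ψ, hψ⟩ := exists_hasIP_one φ hφ
      exact ⟨n', ψ, hψ.of_isComplete hT⟩
    obtain ⟨A, hA, hle⟩ := exists_power_le_card_imageConjClasses (X := X) (B := B) hφ hC hθ0
      (le_self_add.trans hθ)
    constructor
    · refine ⟨?_, fun c hc => (hle.trans (card_imageConjClasses_le_card_bType A)).trans
        (hc ⟨A, hA, rfl⟩)⟩
      rintro _ ⟨A, hA, rfl⟩
      exact card_bType_le hL hX hA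
    · refine ⟨?_, fun c hc => hle.trans (hc ⟨A, hA, rfl⟩)⟩
      rintro _ ⟨A, hA, rfl⟩
      exact (card_imageConjClasses_le_card_bType A).trans (card_bType_le hL hX hA)
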